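/- Let $N\ge 2$, $\mathbf{p}\in[2,\infty)$, $s\in(\tfrac12,1)$. Let $\alpha_{\mathbf p}\in(0,\frac{\pi}{2}]$ be the angle such that the spherical cup $A_{\mathbf p}=\{|z|=1,\ \angle(e_1,z)<\alpha_{\mathbf p}\}\subset\mathbb{R}^N$ satisfies $\mathbf{p}-1=\int_{A_{\mathbf p}}\langle z,e_1\rangle^2\,d\sigma\big/\int_{A_{\mathbf p}}\langle z,e_2\rangle^2\,d\sigma$, and let $T=\{z\in\mathbb{R}^N:\ \angle(e_1,z)<\alpha_{\mathbf p},\ |z|>1\}$. Let $\mathbb{P}$ be the law of an i.i.d. sequence $(z_n,s_n)_{n\ge1}$, where $z_n$ is distributed on $T$ according to the normalisation of the measure $|z|^{-N-2s}\,dz$, and $s_n$ is uniform on $\{1,2\}$ and independent of $z_n$. A strategy is a sequence of Borel maps $\sigma^n$, $n\ge 0$, assigning a unit vector to each finite history $(x_0,(x_1,z_1,s_1),\dots,(x_n,z_n,s_n))$. For a starting point $x_0$, $\epsilon>0$, and strategies $\sigma_I,\sigma_{II}$ of Players I and II, the game position is given by $X_0=x_0$ and $$X_n=X_{n-1}+\epsilon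 R_{y}z_n,\qquad y=\sigma_I^{n-1}\ \text{if } s_n=1,\qquad y=\sigma_{II}^{n-1}\ \text{if } s_n=2,$$ the strategies being evaluated at the history of the first $n-1$ rounds. Here $R_y\in SO(N)$ is the rotation in the plane spanned by $e_1$ and $y$ with $R_ye_1=y$ ($R_{e_1}=\mathrm{Id}$; for $y=-e_1$ the plane of $e_1,e_2$ is used). For a set $\mathcal{D}$, let $\tau=\min\{n\ge1:\ X_n\notin\mathcal{D}\}$, with $\tau=\infty$ if there is no such $n$. **Theorem.** Let $C=\{z:\ \angle(v,z)<\beta,\ 0<|z|<h\}$ be a finite cone, where $|v|=1$, $\beta\in(0,\pi)$, $h>0$. There exists a constant $\bar\theta<1$, depending only on $N,\mathbf{p},s$ and $C$, such that the following holds for every open, bounded set $\mathcal{D}\subset\mathbb{R}^N$ with the property that for each $x\in\partial\mathcal{D}$ there is a rotation $S_x\in SO(N)$ with $x+S_xC\subset\mathbb{R}^N\setminus\mathcal{D}$. For every $\delta>0$ there exist $\hat\delta\in(0,\delta)$ and $\hat\epsilon>0$ such that for all $\epsilon\in(0,\hat\epsilon)$, all $x\in\partial\mathcal{D}$ and all $x_0\in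 B_{\hat\delta}(x)\cap\mathcal{D}$ there exists a strategy $\sigma_{I}$ of Player I such that for all strategies $\sigma_{II}$ of Player II: $$\mathbb{P}\big(\exists\, n<\tau:\ X_n\notin B_\delta(x)\big)\le\bar\theta .$$ -/

import Mathlib

open MeasureTheory ProbabilityTheory

namespace FracTug

/-- The space `ℝ^N` with its Euclidean norm. -/
abbrev E (N : ℕ) : Type := EuclideanSpace ℝ (Fin N)

/-- The coordinate vectors, counted from zero: `coordVec N 0` is the vector written `e₁` in print
and `coordVec N 1` is `e₂` (the value is `0` if `N ≤ k`, which does not occur below for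
`k = 0, 1` and `2 ≤ N`). -/
noncomputable def coordVec (N k : ℕ) : E N :=
  WithLp.toLp 2 (fun i : Fin N => if i.val = k then (1 : ℝ) else 0)

/-- The normalising constant `C(N,s) = 4^s s Γ(N/2 + s) / (π^{N/2} Γ(1 - s))`. -/
noncomputable def fracConst (N : ℕ) (s : ℝ) : ℝ :=
  (4 : ℝ) ^ s * s * Real.Gamma ((N : ℝ) / 2 + s) /
    (Real.pi ^ ((N : ℝ) / 2) * Real.Gamma (1 - s))

/-- The measure `dμ_s^N(z) = C(N,s) |z|^{-N-2s} dz` on `ℝ^N`. -/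
noncomputable def fracMeasure (N : ℕ) (s : ℝ) : Measure (E N) :=
  (volume : Measure (E N)).withDensity
    (fun z => ENNReal.ofReal (fracConst N s / ‖z‖ ^ ((N : ℝ) + 2 * s)))

/-- The spherical cup `{z ; |z| = 1, ∠(e₁, z) < α}`, as a subset of the unit sphere. -/
def cap (N : ℕ) (α : ℝ) : Set (Metric.sphere (0 : E N) 1) :=
  {z | InnerProductGeometry.angle (coordVec N 0) (z : E N) < α}

/-- `∫ ⟨z, e⟩² dσ(z)` over the spherical cup of angle `α`, with `σ` the surface measure. -/
noncomputable def capMoment (N : ℕ) (α : ℝ) (e : E N) : ℝ :=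
  ∫ z in cap N α, (inner ℝ (z : E N) e) ^ 2 ∂((volume : Measure (E N)).toSphere)

/-- `α ∈ (0, π/2]` and `p - 1` is the quotient of the integrals of `⟨z,e₁⟩²` and `⟨z,e₂⟩²` over the
spherical cup of angle `α`. -/
def IsApertureAngle (N : ℕ) (p α : ℝ) : Prop :=
  α ∈ Set.Ioc 0 (Real.pi / 2) ∧
    p - 1 = capMoment N α (coordVec N 0) / capMoment N α (coordVec N 1)

open Classical in
/-- The angle `α_p`. For `2 ≤ N` and `2 ≤ p` there is exactly one angle with the property
`IsApertureAngle N p`, since the quotient of the two integrals decreases strictly from `∞` to `1` as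
the angle increases from `0` to `π/2`; so the default value in the second branch is never used. -/
noncomputable def apertureAngle (N : ℕ) (p : ℝ) : ℝ :=
  if h : ∃ α, IsApertureAngle N p α then h.choose else Real.pi / 2

/-- The truncated infinite cone `T_p^{1,∞} = {z ; ∠(e₁, z) < α_p, 1 < |z|}`. -/
def truncCone (N : ℕ) (p : ℝ) : Set (E N) :=
  {z | InnerProductGeometry.angle (coordVec N 0) z < apertureAngle N p ∧ 1 < ‖z‖}

open Classical in
/-- The rotation `R_{y, e₁} ∈ SO(N)` in the plane spanned by `e₁` and the unit vector `y` that takes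
`e₁` to `y`, written as the composition of the reflections in the hyperplanes orthogonal to `e₁`
(first) and to `e₁ + y`; it is the identity for `y = e₁`. For `y = -e₁`, where the plane is not
determined, the plane of `e₁` and `e₂` is taken. -/
noncomputable def rot {N : ℕ} (y : E N) : E N ≃ₗᵢ[ℝ] E N :=
  ((Submodule.span ℝ {coordVec N 0})ᗮ.reflection).trans
    ((Submodule.span ℝ
      {if y = -coordVec N 0 then coordVec N 1 else coordVec N 0 + y})ᗮ.reflection)

/-- One round of random data `(z, s)`; `true` is the outcome `s = 1` (direction chosen by Player I
is used), `false` is the outcome `s = 2` (direction chosen by Player II is used). The vector `z` has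
a law that is carried by `T_p^{1,∞}`, see `stepLaw`. -/
abbrev Outcome (N : ℕ) : Type := E N × Bool

/-- The probability `ℙ₁`: the normalisation of `μ_s^N` on `T_p^{1,∞}`, times the fair coin. -/
noncomputable def stepLaw (N : ℕ) (p s : ℝ) : Measure (Outcome N) :=
  ((fracMeasure N s)[|truncCone N p]).prod (uniformOn (Set.univ : Set Bool))

/-- The probability `ℙ` on `Ω`: the countable product of copies of `ℙ₁`. (The value `ω n` is the
random data of round `n + 1`.) -/
noncomputable def gameLaw (N : ℕ) (p s : ℝ) : Measure (ℕ → Outcome N) :=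
  Measure.infinitePi (fun _ : ℕ => stepLaw N p s)

/-- Finite histories `(x₀, (x₁, z₁, s₁), …, (xₙ, zₙ, sₙ))`. -/
abbrev History (N n : ℕ) : Type := E N × (Fin n → E N × Outcome N)

/-- A strategy: for each `n` a Borel function of the history with values in the unit vectors. -/
structure Strategy (N : ℕ) where
  dir : ∀ n : ℕ, History N n → Metric.sphere (0 : E N) 1
  measurable_dir : ∀ n : ℕ, Measurable (dir n)

/-- The current game position recorded in a history. -/
def History.pos {N : ℕ} : {n : ℕ} → History N n → E N
  | 0, H => H.1
  | n + 1, H => (H.2 (Fin.last n)).1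

/-- The history of the first `n` rounds of the game with parameter `ε` and starting point `x`. In
round `n + 1` the position is advanced by `ε R_{y, e₁} z`, where `(z, s) = ω n` and `y` is the
direction chosen by Player I if `s = 1` and the one chosen by Player II if `s = 2`. -/
noncomputable def history {N : ℕ} (ε : ℝ) (x : E N) (σI σII : Strategy N) (ω : ℕ → Outcome N) :
    (n : ℕ) → History N n
  | 0 => (x, Fin.elim0)
  | n + 1 =>
    let H := history ε x σI σII ω n
    let y : Metric.sphere (0 : E N) 1 := if (ω n).2 = true then σI.dir n H else σII.dir n H
    (x, Fin.snoc H.2 (H.pos + ε • rot (y : E N) (ω n).1, ω n))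

/-- The game position `X_n^{ε, x, σ_I, σ_II}`. -/
noncomputable def position {N : ℕ} (ε : ℝ) (x : E N) (σI σII : Strategy N) (n : ℕ)
    (ω : ℕ → Outcome N) : E N :=
  (history ε x σI σII ω n).pos

/-- The exit time `τ = min {n ≥ 1 ; X_n ∉ D}`, with value `∞` if there is no such `n`. -/
noncomputable def exitTime {N : ℕ} (D : Set (E N)) (ε : ℝ) (x : E N) (σI σII : Strategy N)
    (ω : ℕ → Outcome N) : ℕ∞ :=
  ⨅ (n : ℕ) (_ : 1 ≤ n ∧ position ε x σI σII n ω ∉ D), (n : ℕ∞)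

/-- The finite (right circular) cone with vertex `0`, axis `v`, half-aperture `β`, height `h`. -/
def finiteCone {N : ℕ} (v : E N) (β h : ℝ) : Set (E N) :=
  {z | InnerProductGeometry.angle v z < β ∧ 0 < ‖z‖ ∧ ‖z‖ < h}

/-- The external cone condition with cone `C`: at each boundary point `x` of `D`, some rotation
`S ∈ SO(N)` satisfies `x + S C ⊆ ℝ^N \ D`. -/
def ExternalCone {N : ℕ} (D C : Set (E N)) : Prop :=
  ∀ x ∈ frontier D, ∃ S : E N ≃ₗᵢ[ℝ] E N,
    LinearMap.det (S.toLinearEquiv : E N →ₗ[ℝ] E N) = 1 ∧ ∀ z ∈ C, x + S z ∉ D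

/-! Well-posedness of the random data. -/

theorem apertureAngle_pos (N : ℕ) (p : ℝ) : 0 < apertureAngle N p := by
  unfold apertureAngle
  split_ifs with h
  · exact h.choose_spec.1.1
  · positivity

theorem norm_coordVec {N k : ℕ} (hk : k < N) : ‖coordVec N k‖ = 1 := by
  have h : coordVec N k = EuclideanSpace.single (⟨k, hk⟩ : Fin N) (1 : ℝ) := by
    ext i
    simp [coordVec, Fin.ext_iff]
  rw [h]; simp

theorem isOpen_truncCone (N : ℕ) (p : ℝ) (hN : 2 ≤ N) : IsOpen (truncCone N p) := by
  rw [isOpen_iff_mem_nhds]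
  rintro z ⟨h1, h2⟩
  have he : coordVec N 0 ≠ 0 := by
    rw [← norm_ne_zero_iff, norm_coordVec (by omega)]; exact one_ne_zero
  have hz : z ≠ 0 := by
    rw [← norm_pos_iff]; linarith
  have hc : ContinuousAt (fun w : E N => InnerProductGeometry.angle (coordVec N 0) w) z :=
    (InnerProductGeometry.continuousAt_angle (x := (coordVec N 0, z)) he hz).comp
      (f := fun w : E N => (coordVec N 0, w)) (by fun_prop)
  filter_upwards [hc.eventually (gt_mem_nhds h1),
    continuous_norm.continuousAt.eventually (lt_mem_nhds h2)] with w hw1 hw2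
  exact ⟨hw1, hw2⟩

theorem nonempty_truncCone (N : ℕ) (p : ℝ) (hN : 2 ≤ N) : (truncCone N p).Nonempty := by
  have h1 := norm_coordVec (N := N) (k := 0) (by omega)
  have he : coordVec N 0 ≠ 0 := by
    rw [← norm_ne_zero_iff, h1]; exact one_ne_zero
  refine ⟨(2 : ℝ) • coordVec N 0, ?_, ?_⟩
  · rw [InnerProductGeometry.angle_smul_right_of_pos _ _ two_pos,
      InnerProductGeometry.angle_self he]
    exact apertureAngle_pos N p
  · rw [norm_smul, h1]; norm_num

theorem fracConst_pos (N : ℕ) {s : ℝ} (hs : s ∈ Set.Ioo (1 / 2 : ℝ) 1) : 0 < fracConst N s := by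
  have h0 : 0 < s := by linarith [hs.1]
  have h1 := Real.Gamma_pos_of_pos (s := (N : ℝ) / 2 + s) (by positivity)
  have h2 := Real.Gamma_pos_of_pos (s := 1 - s) (by linarith [hs.2])
  have := Real.pi_pos
  unfold fracConst
  positivity

theorem fracMeasure_truncCone_ne_zero (N : ℕ) (p : ℝ) (hN : 2 ≤ N) {s : ℝ}
    (hs : s ∈ Set.Ioo (1 / 2 : ℝ) 1) : fracMeasure N s (truncCone N p) ≠ 0 := by
  have hO := isOpen_truncCone N p hN
  rw [fracMeasure, withDensity_apply _ hO.measurableSet, Ne,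
    lintegral_eq_zero_iff (by fun_prop), Filter.EventuallyEq,
    ae_restrict_iff' hO.measurableSet]
  intro h
  have hv : (volume : Measure (E N)) (truncCone N p) = 0 := by
    refine measure_mono_null (fun z hz => ?_) (ae_iff.1 h)
    have hz1 : 0 < ‖z‖ := lt_trans one_pos hz.2
    have : 0 < fracConst N s / ‖z‖ ^ ((N : ℝ) + 2 * s) :=
      div_pos (fracConst_pos N hs) (Real.rpow_pos_of_pos hz1 _)
    simp only [Set.mem_ofPred_eq, Pi.zero_apply, ENNReal.ofReal_eq_zero, not_forall]
    exact ⟨hz, not_le.2 this⟩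
  exact (hO.measure_pos volume (nonempty_truncCone N p hN)).ne' hv

theorem fracMeasure_truncCone_ne_top (N : ℕ) (p : ℝ) (hN : 2 ≤ N) {s : ℝ}
    (hs : s ∈ Set.Ioo (1 / 2 : ℝ) 1) : fracMeasure N s (truncCone N p) ≠ ⊤ := by
  have hO := isOpen_truncCone N p hN
  have h0 : 0 < s := by linarith [hs.1]
  rw [fracMeasure, withDensity_apply _ hO.measurableSet]
  set r : ℝ := (N : ℝ) + 2 * s with hr
  have hr0 : 0 < r := by positivity
  have hc := fracConst_pos N hs
  have hfin : (∫⁻ z : E N, ENNReal.ofReal ((1 + ‖z‖) ^ (-r))) < ⊤ :=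
    finite_integral_one_add_norm (by simp [hr]; exact h0)
  refine ne_top_of_le_ne_top
    (ENNReal.mul_ne_top (ENNReal.ofReal_ne_top (r := fracConst N s * 2 ^ r)) hfin.ne) ?_
  rw [← lintegral_const_mul _ (by fun_prop)]
  refine le_trans (setLIntegral_mono' hO.measurableSet (fun z hz => ?_))
    (setLIntegral_le_lintegral _ _)
  rw [← ENNReal.ofReal_mul (by positivity)]
  refine ENNReal.ofReal_le_ofReal ?_
  have hz1 : 1 < ‖z‖ := hz.2
  have hz0 : 0 < ‖z‖ := by linarith
  have key : (1 + ‖z‖) ^ r ≤ 2 ^ r * ‖z‖ ^ r := by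
    rw [← Real.mul_rpow (by norm_num) hz0.le]
    exact Real.rpow_le_rpow (by positivity) (by linarith) hr0.le
  rw [Real.rpow_neg (by positivity), mul_assoc, div_eq_mul_inv]
  refine mul_le_mul_of_nonneg_left ?_ hc.le
  rw [← div_eq_mul_inv, inv_eq_one_div, div_le_div_iff₀ (by positivity) (by positivity), one_mul]
  exact key

theorem isProbabilityMeasure_stepLaw (N : ℕ) (p : ℝ) (hN : 2 ≤ N) {s : ℝ}
    (hs : s ∈ Set.Ioo (1 / 2 : ℝ) 1) : IsProbabilityMeasure (stepLaw N p s) := by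
  have h1 : IsProbabilityMeasure ((fracMeasure N s)[|truncCone N p]) :=
    cond_isProbabilityMeasure_of_finite (fracMeasure_truncCone_ne_zero N p hN hs)
      (fracMeasure_truncCone_ne_top N p hN hs)
  have h2 : IsProbabilityMeasure (uniformOn (Set.univ : Set Bool)) :=
    isProbabilityMeasure_uniformOn Set.finite_univ Set.univ_nonempty
  unfold stepLaw
  infer_instance

theorem isProbabilityMeasure_gameLaw (N : ℕ) (p : ℝ) (hN : 2 ≤ N) {s : ℝ}
    (hs : s ∈ Set.Ioo (1 / 2 : ℝ) 1) : IsProbabilityMeasure (gameLaw N p s) := by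
  have := isProbabilityMeasure_stepLaw N p hN hs
  unfold gameLaw
  infer_instance

end FracTug

/-!
The cone at `x` contains a ball outside `D`, and Player I always aims at its centre `z₀`. The
function `a ↦ ‖a‖ ^ (-2 k)`, centred at `z₀` and truncated near `z₀`, is a submartingale for every
large `k`, whatever Player II does. Indeed, from a position at distance `‖a‖` from `z₀`, consider
the jumps of length at most `M = ‖a‖ / (2 ε)`. Their mean is a nonnegative multiple of `e₁`, so the
first-order contribution of Player I's turn is at least as large as the loss in Player II's turn.
Up to the factor `M ^ (-2 s)`, the curvature and the neglected longer jumps cost `O(k)`, while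
Player I's jumps that are almost straight and of length comparable to `M` gain a multiple of
`(16 / 11) ^ k`. The maximal inequality for this submartingale bounds the probability of moving
farther from `z₀` by a constant factor before leaving `D`.
-/

namespace FracTug

open scoped Pointwise

section Barrier

variable {V : Type*} [NormedAddCommGroup V]

/-- The power `‖a‖ ^ (-2 k)`, truncated at radius `c` and normalised to the value `1` there. Around
a centre outside the domain it is a submartingale for the position of the game. -/
noncomputable def barrier (k : ℕ) (c : ℝ) (a : V) : ℝ := (c / max ‖a‖ c) ^ (2 * k)

theorem measurable_barrier [MeasurableSpace V] [OpensMeasurableSpace V] (k : ℕ) (c : ℝ) :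
    Measurable (barrier k c : V → ℝ) := by
  unfold barrier; fun_prop

theorem barrier_nonneg (k : ℕ) (c : ℝ) (a : V) : 0 ≤ barrier k c a :=
  (even_two_mul k).pow_nonneg _

theorem barrier_le_one (k : ℕ) {c : ℝ} (hc : 0 ≤ c) (a : V) : barrier k c a ≤ 1 :=
  pow_le_one₀ (div_nonneg hc (le_max_of_le_right hc))
    (div_le_one_of_le₀ (le_max_right _ _) (le_max_of_le_right hc))

theorem barrier_le (k : ℕ) {c R : ℝ} (hc : 0 ≤ c) (hR : 0 < R) {a : V} (ha : R ≤ ‖a‖) :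
    barrier k c a ≤ (c / R) ^ (2 * k) := by
  unfold barrier
  gcongr
  exact le_max_of_le_left ha

theorem le_barrier (k : ℕ) {c R : ℝ} (hc : 0 < c) (hcR : c ≤ R) {a : V} (ha : ‖a‖ ≤ R) :
    (c / R) ^ (2 * k) ≤ barrier k c a := by
  have : 0 < max ‖a‖ c := lt_max_of_lt_right hc
  unfold barrier
  have : 0 ≤ c / R := div_nonneg hc.le (hc.le.trans hcR)
  gcongr
  exact max_le ha hcR

theorem integrable_barrier_comp [MeasurableSpace V] [OpensMeasurableSpace V] {Ω : Type*}
    [MeasurableSpace Ω] (P : Measure Ω) [IsFiniteMeasure P] (k : ℕ) {c : ℝ} (hc : 0 ≤ c)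
    {f : Ω → V} (hf : Measurable f) : Integrable (fun ω => barrier k c (f ω)) P :=
  .of_bound ((measurable_barrier k c).comp hf).aestronglyMeasurable 1 <| .of_forall fun _ =>
    (Real.norm_of_nonneg (barrier_nonneg k c _)).trans_le (barrier_le_one k hc _)

theorem barrier_eq_mul (k : ℕ) {c : ℝ} {a b : V} (ha : 0 < ‖a‖) (hca : c ≤ ‖a‖) (hcb : c ≤ ‖b‖) :
    barrier k c b = barrier k c a * ((‖b‖ ^ 2 / ‖a‖ ^ 2)⁻¹) ^ k := by
  rw [barrier, barrier, max_eq_left hca, max_eq_left hcb, pow_mul, pow_mul, ← mul_pow]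
  congr 1
  field_simp

theorem le_norm_add_of_two_mul_le {c : ℝ} {a u : V} (hca : 2 * c ≤ ‖a‖) (hu : 2 * ‖u‖ ≤ ‖a‖) :
    c ≤ ‖a + u‖ := by
  linarith [norm_sub_le_norm_add a u]

theorem one_sub_mul_le_inv_pow (k : ℕ) {q : ℝ} (hq : 0 < q) : 1 - k * (q - 1) ≤ q⁻¹ ^ k := by
  have h : 1 - q ≤ q⁻¹ - 1 := by
    rw [← sub_nonneg, show q⁻¹ - 1 - (1 - q) = (1 - q) ^ 2 / q by field_simp]
    positivity
  calc 1 - k * (q - 1) = 1 + k * (1 - q) := by ring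
    _ ≤ 1 + k * (q⁻¹ - 1) := by gcongr
    _ ≤ q⁻¹ ^ k := one_add_mul_sub_le_pow (by linarith [inv_pos.2 hq]) k

variable [InnerProductSpace ℝ V]

theorem barrier_mul_one_sub_le (k : ℕ) {c : ℝ} (hc : 0 < c) {a u : V} (hca : 2 * c ≤ ‖a‖)
    (hu : 2 * ‖u‖ ≤ ‖a‖) :
    barrier k c a * (1 - k * ((2 * inner ℝ a u + ‖u‖ ^ 2) / ‖a‖ ^ 2)) ≤ barrier k c (a + u) := by
  have ha : 0 < ‖a‖ := by linarith
  have hcau := le_norm_add_of_two_mul_le hca hu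
  have hau : 0 < ‖a + u‖ := hc.trans_le hcau
  rw [barrier_eq_mul k ha (by linarith) hcau]
  refine mul_le_mul_of_nonneg_left ?_ (barrier_nonneg k c a)
  have hratio : (2 * inner ℝ a u + ‖u‖ ^ 2) / ‖a‖ ^ 2 = ‖a + u‖ ^ 2 / ‖a‖ ^ 2 - 1 := by
    rw [norm_add_sq_real]
    field_simp
    ring
  rw [hratio]
  exact one_sub_mul_le_inv_pow k (by positivity)

theorem barrier_mul_pow_le (k : ℕ) {c : ℝ} (hc : 0 < c) {a u : V} (hca : 2 * c ≤ ‖a‖)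
    (hlo : ‖a‖ < 4 * ‖u‖) (hhi : 2 * ‖u‖ < ‖a‖)
    (hinner : inner ℝ a u ≤ -(3 / 4 * (‖a‖ * ‖u‖))) :
    barrier k c a * (16 / 11) ^ k ≤ barrier k c (a + u) := by
  have ha : 0 < ‖a‖ := by linarith
  have hcau := le_norm_add_of_two_mul_le hca hhi.le
  have hau : 0 < ‖a + u‖ := hc.trans_le hcau
  have hsq : ‖a + u‖ ^ 2 ≤ 11 / 16 * ‖a‖ ^ 2 := by
    rw [norm_add_sq_real]
    nlinarith [mul_pos (sub_pos.2 hlo) (sub_pos.2 hhi)]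
  rw [barrier_eq_mul k ha (by linarith) hcau]
  have := barrier_nonneg k c a
  gcongr
  rw [inv_div, div_le_div_iff₀ (by norm_num) (by positivity)]
  linarith

theorem barrier_mul_one_sub_add_le (k : ℕ) {c : ℝ} (hc : 0 < c) {a u : V} (hca : 2 * c ≤ ‖a‖)
    (hlo : ‖a‖ < 4 * ‖u‖) (hhi : 2 * ‖u‖ < ‖a‖)
    (hinner : inner ℝ a u ≤ -(3 / 4 * (‖a‖ * ‖u‖))) :
    barrier k c a * (1 - k * ((2 * inner ℝ a u + ‖u‖ ^ 2) / ‖a‖ ^ 2) +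
      ((16 / 11) ^ k - 1 - k)) ≤ barrier k c (a + u) := by
  have ha : 0 < ‖a‖ := by linarith
  have hquad : -1 ≤ (2 * inner ℝ a u + ‖u‖ ^ 2) / ‖a‖ ^ 2 := by
    rw [le_div_iff₀ (by positivity)]
    linarith [norm_add_sq_real a u, sq_nonneg ‖a + u‖]
  refine le_trans ?_ (barrier_mul_pow_le k hc hca hlo hhi hinner)
  refine mul_le_mul_of_nonneg_left ?_ (barrier_nonneg k c a)
  linarith [mul_le_mul_of_nonneg_left hquad (Nat.cast_nonneg (α := ℝ) k)]

end Barrier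

section IntegratedBarrier

variable {V Ω : Type*} [NormedAddCommGroup V] [InnerProductSpace ℝ V] [CompleteSpace V]
  [MeasurableSpace V] [BorelSpace V] [SecondCountableTopology V] {mΩ : MeasurableSpace Ω}

/-- The function `g` records how far the barrier exceeds its quadratic lower bound. -/
theorem barrier_mul_le_integral (P : Measure Ω) [IsFiniteMeasure P] (k : ℕ) {c : ℝ} (hc : 0 ≤ c)
    (a : V) {U : Ω → V} (hU : Measurable U) {g : Ω → ℝ}
    (hg : IntegrableOn g {ω | ‖U ω‖ ≤ ‖a‖ / 2} P)
    (hstep : ∀ ω, ‖U ω‖ ≤ ‖a‖ / 2 →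
      barrier k c a * (1 - k * ((2 * inner ℝ a (U ω) + ‖U ω‖ ^ 2) / ‖a‖ ^ 2) + g ω) ≤
        barrier k c (a + U ω)) :
    barrier k c a * (P.real {ω | ‖U ω‖ ≤ ‖a‖ / 2} -
        k * ((2 * inner ℝ a (∫ ω in {ω | ‖U ω‖ ≤ ‖a‖ / 2}, U ω ∂P) +
          ∫ ω in {ω | ‖U ω‖ ≤ ‖a‖ / 2}, ‖U ω‖ ^ 2 ∂P) / ‖a‖ ^ 2) +
        ∫ ω in {ω | ‖U ω‖ ≤ ‖a‖ / 2}, g ω ∂P) ≤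
      ∫ ω, barrier k c (a + U ω) ∂P := by
  set B := {ω | ‖U ω‖ ≤ ‖a‖ / 2}
  have hB : MeasurableSet B := measurableSet_le hU.norm measurable_const
  have hUB : ∀ᵐ ω ∂P.restrict B, ‖U ω‖ ≤ ‖a‖ / 2 := ae_restrict_mem hB
  have hUint : IntegrableOn U B P :=
    .of_bound (measure_lt_top P B) hU.aestronglyMeasurable _ hUB
  have hinner : IntegrableOn (fun ω => inner ℝ a (U ω)) B P := hUint.const_inner a
  have hsq : IntegrableOn (fun ω => ‖U ω‖ ^ 2) B P := by
    refine .of_bound (measure_lt_top P B) (hU.norm.pow_const 2).aestronglyMeasurable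
      ((‖a‖ / 2) ^ 2) ?_
    filter_upwards [hUB] with ω hω
    rw [norm_pow, norm_norm]
    gcongr
  have hbar := integrable_barrier_comp P k hc (hU.const_add a)
  have hquad : IntegrableOn (fun ω => k * ((2 * inner ℝ a (U ω) + ‖U ω‖ ^ 2) / ‖a‖ ^ 2)) B P :=
    (((hinner.const_mul 2).add hsq).div_const _).const_mul _
  have hsub : IntegrableOn
      (fun ω => 1 - k * ((2 * inner ℝ a (U ω) + ‖U ω‖ ^ 2) / ‖a‖ ^ 2)) B P :=
    (integrable_const 1).sub hquad
  have hlow : IntegrableOn (fun ω => barrier k c a *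
      (1 - k * ((2 * inner ℝ a (U ω) + ‖U ω‖ ^ 2) / ‖a‖ ^ 2) + g ω)) B P :=
    (hsub.add hg).const_mul _
  calc _ = ∫ ω in B, barrier k c a *
        (1 - k * ((2 * inner ℝ a (U ω) + ‖U ω‖ ^ 2) / ‖a‖ ^ 2) + g ω) ∂P := by
        rw [integral_const_mul, integral_add hsub hg, integral_sub (integrable_const 1) hquad,
          integral_const_mul, integral_div, integral_add (hinner.const_mul 2) hsq,
          integral_const_mul, integral_inner hUint, setIntegral_const, smul_eq_mul, mul_one]
    _ ≤ ∫ ω in B, barrier k c (a + U ω) ∂P :=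
        setIntegral_mono_on hlow hbar.integrableOn hB hstep
    _ ≤ ∫ ω, barrier k c (a + U ω) ∂P :=
        setIntegral_le_integral hbar (.of_forall fun ω => barrier_nonneg k c _)

end IntegratedBarrier

section InfiniteProduct

variable {ι : Type*} {S : ι → Type*} [∀ i, MeasurableSpace (S i)] (μ : ∀ i, Measure (S i))
  [∀ i, IsProbabilityMeasure (μ i)]

theorem measurePreserving_update [DecidableEq ι] (i : ι) :
    MeasurePreserving (fun q : (∀ j, S j) × S i => Function.update q.1 i q.2)
      ((Measure.infinitePi μ).prod (μ i)) (Measure.infinitePi μ) := by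
  refine ⟨measurable_update', Measure.eq_infinitePi μ fun s t ht => ?_⟩
  rw [Measure.map_apply measurable_update' (.pi s.countable_toSet fun j _ => ht j)]
  by_cases hi : i ∈ s
  · have hpre : (fun q : (∀ j, S j) × S i => Function.update q.1 i q.2) ⁻¹' Set.pi s t =
        Set.pi (s.erase i) t ×ˢ t i := by
      ext q
      rw [Set.mem_preimage, Set.update_mem_pi_iff]
      simp [hi]
    rw [hpre, Measure.prod_prod, Measure.infinitePi_pi μ fun j _ => ht j,
      Finset.prod_erase_mul s _ hi]
  · have hpre : (fun q : (∀ j, S j) × S i => Function.update q.1 i q.2) ⁻¹' Set.pi s t =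
        Set.pi s t ×ˢ Set.univ := by
      ext q
      rw [Set.mem_preimage, Set.update_mem_pi_iff]
      simp [hi]
    rw [hpre, Measure.prod_prod, Measure.infinitePi_pi μ fun j _ => ht j, measure_univ, mul_one]

open Classical in
theorem lintegral_infinitePi_eval (i : ι) {F : (∀ j, S j) → S i → ENNReal}
    (hF : Measurable (Function.uncurry F)) (hdep : DependsOn F {i}ᶜ) :
    ∫⁻ ω, F ω (ω i) ∂(Measure.infinitePi μ) =
      ∫⁻ ω, ∫⁻ o, F ω o ∂(μ i) ∂(Measure.infinitePi μ) := by
  have hG : Measurable fun ω : ∀ j, S j => F ω (ω i) :=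
    hF.comp (measurable_id.prodMk (measurable_pi_apply i))
  calc ∫⁻ ω, F ω (ω i) ∂(Measure.infinitePi μ)
      = ∫⁻ q, F q.1 q.2 ∂((Measure.infinitePi μ).prod (μ i)) := by
        rw [← (measurePreserving_update μ i).lintegral_comp hG]
        refine lintegral_congr fun q => ?_
        have hoff : F (Function.update q.1 i q.2) = F q.1 :=
          hdep fun j hj => Function.update_of_ne hj _ _
        rw [hoff, Function.update_self]
    _ = _ := lintegral_prod _ hF.aemeasurable

end InfiniteProduct

section MaximalInequality

variable {Ω S : Type*} [MeasurableSpace Ω] [MeasurableSpace S]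

/-- Maximal inequality for a process that is a supermartingale as long as it stays in `G`. -/
theorem measure_exists_enter_le (μ : Measure Ω) {X : ℕ → Ω → S} (hX : ∀ n, Measurable (X n))
    {G K : Set S} (hG : MeasurableSet G) (hK : MeasurableSet K) (hGK : Disjoint G K)
    {v : S → ENNReal} (hvK : ∀ x ∈ K, 1 ≤ v x)
    (hstep : ∀ n, ∫⁻ ω in {ω | ∀ k < n + 1, X k ω ∈ G}, v (X (n + 1) ω) ∂μ ≤
      ∫⁻ ω in {ω | ∀ k < n + 1, X k ω ∈ G}, v (X n ω) ∂μ) :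
    μ {ω | ∃ n, (∀ k < n, X k ω ∈ G) ∧ X n ω ∈ K} ≤ ∫⁻ ω, v (X 0 ω) ∂μ := by
  set A : ℕ → Set Ω := fun n => {ω | ∀ k < n, X k ω ∈ G} with hA
  have hAm : ∀ n, MeasurableSet (A n) := fun n => by
    simp only [hA, Set.ofPred_forall]
    exact .iInter fun k => .iInter fun _ => hX k hG
  have hAE : ∀ n, MeasurableSet (A n ∩ X n ⁻¹' K) := fun n => (hAm n).inter (hX n hK)
  have hdecr : ∀ n, (∫⁻ ω in A (n + 1), v (X (n + 1) ω) ∂μ) + μ (A n ∩ X n ⁻¹' K) ≤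
      ∫⁻ ω in A n, v (X n ω) ∂μ := by
    intro n
    have hdisj : Disjoint (A (n + 1)) (A n ∩ X n ⁻¹' K) :=
      Set.disjoint_left.2 fun ω h h' => Set.disjoint_left.1 hGK (h n n.lt_succ_self) h'.2
    have hsub : A (n + 1) ∪ A n ∩ X n ⁻¹' K ⊆ A n :=
      Set.union_subset (fun ω h k hk => h k (hk.trans n.lt_succ_self)) Set.inter_subset_left
    calc _ ≤ (∫⁻ ω in A (n + 1), v (X n ω) ∂μ) + ∫⁻ ω in A n ∩ X n ⁻¹' K, v (X n ω) ∂μ := by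
          refine add_le_add (hstep n) ?_
          rw [← setLIntegral_one]
          exact setLIntegral_mono' (hAE n) fun ω hω => hvK _ hω.2
      _ = ∫⁻ ω in A (n + 1) ∪ A n ∩ X n ⁻¹' K, v (X n ω) ∂μ :=
          (lintegral_union (hAE n) hdisj).symm
      _ ≤ _ := lintegral_mono_set hsub
  have hsum : ∀ n, (∫⁻ ω in A n, v (X n ω) ∂μ) + ∑ k ∈ Finset.range n, μ (A k ∩ X k ⁻¹' K) ≤
      ∫⁻ ω, v (X 0 ω) ∂μ := by
    intro n
    induction n with
    | zero => simp [hA]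
    | succ n ih =>
      rw [Finset.sum_range_succ, add_comm (Finset.sum _ _), ← add_assoc]
      exact (add_le_add_left (hdecr n) _).trans ih
  have hset : {ω | ∃ n, (∀ k < n, X k ω ∈ G) ∧ X n ω ∈ K} = ⋃ n, A n ∩ X n ⁻¹' K := by
    ext ω; simp [A]
  rw [hset]
  refine (measure_iUnion_le _).trans ?_
  rw [ENNReal.tsum_eq_iSup_nat]
  exact iSup_le fun n => le_add_self.trans (hsum n)

end MaximalInequality

theorem setLIntegral_Ioc_rpow_sub_one {r M : ℝ} (hr : 0 < r) (hM : 0 ≤ M) :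
    ∫⁻ t in Set.Ioc 0 M, ENNReal.ofReal (t ^ (r - 1)) = ENNReal.ofReal (M ^ r / r) := by
  rw [← ofReal_integral_eq_lintegral_ofReal, ← intervalIntegral.integral_of_le hM,
    integral_rpow (.inl (by linarith)), sub_add_cancel, Real.zero_rpow hr.ne', sub_zero]
  · exact (intervalIntegrable_iff_integrableOn_Ioc_of_le hM).1
      (intervalIntegral.intervalIntegrable_rpow' (by linarith))
  · filter_upwards [ae_restrict_mem measurableSet_Ioc] with t ht
    exact Real.rpow_nonneg ht.1.le _

theorem setIntegral_rpow_le_of_tail {Ω : Type*} {mΩ : MeasurableSpace Ω} (P : Measure Ω)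
    {f : Ω → ℝ} (hf : Measurable f) (hf0 : ∀ ω, 0 ≤ f ω) {q r : ℝ} (hr : 0 < r) (hqr : q < r)
    (htail : ∀ t, 0 < t → P {ω | t < f ω} ≤ ENNReal.ofReal (t ^ (-q))) {M : ℝ} (hM : 0 ≤ M) :
    ∫ ω in {ω | f ω ≤ M}, f ω ^ r ∂P ≤ r / (r - q) * M ^ (r - q) := by
  set B := {ω | f ω ≤ M}
  have hrestrict : ∀ t ∈ Set.Ioi (0 : ℝ),
      P.restrict B {ω | t < f ω} * ENNReal.ofReal (t ^ (r - 1)) ≤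
        (Set.Ioc 0 M).indicator (fun t => ENNReal.ofReal (t ^ (r - q - 1))) t := by
    intro t (ht : 0 < t)
    rw [Measure.restrict_apply (measurableSet_lt measurable_const hf)]
    rcases le_or_gt t M with htM | hMt
    · rw [Set.indicator_of_mem (show t ∈ Set.Ioc 0 M from ⟨ht, htM⟩)]
      calc _ ≤ ENNReal.ofReal (t ^ (-q)) * ENNReal.ofReal (t ^ (r - 1)) := by
            gcongr
            exact (measure_mono Set.inter_subset_left).trans (htail t ht)
        _ = _ := by
            rw [← ENNReal.ofReal_mul (by positivity), ← Real.rpow_add ht]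
            ring_nf
    · have hempty : {ω | t < f ω} ∩ B = ∅ :=
        Set.eq_empty_of_forall_notMem fun ω hω => (hω.2.trans_lt hMt).not_gt hω.1
      simp [hempty]
  rw [integral_eq_lintegral_of_nonneg_ae (.of_forall fun ω => Real.rpow_nonneg (hf0 ω) r)
    (hf.pow_const r).aestronglyMeasurable]
  refine ENNReal.toReal_le_of_le_ofReal
    (mul_nonneg (div_nonneg hr.le (by linarith)) (by positivity)) ?_
  calc ∫⁻ ω in B, ENNReal.ofReal (f ω ^ r) ∂P
      = ENNReal.ofReal r * ∫⁻ t in Set.Ioi 0,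
          P.restrict B {ω | t < f ω} * ENNReal.ofReal (t ^ (r - 1)) :=
        lintegral_rpow_eq_lintegral_meas_lt_mul _ (.of_forall hf0) hf.aemeasurable hr
    _ ≤ ENNReal.ofReal r * ∫⁻ t in Set.Ioc 0 M, ENNReal.ofReal (t ^ (r - q - 1)) := by
        rw [← lintegral_indicator measurableSet_Ioc]
        exact mul_le_mul_right ((setLIntegral_mono' measurableSet_Ioi hrestrict).trans
          (setLIntegral_le_lintegral _ _)) _
    _ = ENNReal.ofReal (r / (r - q) * M ^ (r - q)) := by
        rw [setLIntegral_Ioc_rpow_sub_one (sub_pos.2 hqr) hM, ← ENNReal.ofReal_mul hr.le]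
        ring_nf

theorem fracConst_pos_of_mem_Ioo (N : ℕ) {s : ℝ} (hs : s ∈ Set.Ioo (0 : ℝ) 1) :
    0 < fracConst N s := by
  have hs0 : 0 < s := hs.1
  have := Real.Gamma_pos_of_pos (s := (N : ℝ) / 2 + s) (by positivity)
  have := Real.Gamma_pos_of_pos (sub_pos.2 hs.2)
  unfold fracConst
  positivity

theorem fracMeasure_ne_zero_of_isOpen (N : ℕ) {s : ℝ} (hs : s ∈ Set.Ioo (0 : ℝ) 1)
    {U : Set (E N)} (hU : IsOpen U) (hne : U.Nonempty) (h0 : (0 : E N) ∉ U) :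
    fracMeasure N s U ≠ 0 := by
  rw [fracMeasure, Ne, withDensity_apply_eq_zero (by fun_prop)]
  refine ne_of_gt ((hU.measure_pos volume hne).trans_le (measure_mono fun z hz => ⟨?_, hz⟩))
  have hz0 : 0 < ‖z‖ := norm_pos_iff.2 (ne_of_mem_of_not_mem hz h0)
  have hc := fracConst_pos_of_mem_Ioo N hs
  simp only [Set.mem_ofPred_eq, Ne, ENNReal.ofReal_eq_zero, not_le]
  positivity

theorem fracMeasure_one_lt_norm_ne_top (N : ℕ) {s : ℝ} (hs : 0 < s) :
    fracMeasure N s {z | 1 < ‖z‖} ≠ ⊤ := by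
  set r : ℝ := N + 2 * s with hr
  have hmeas : MeasurableSet {z : E N | 1 < ‖z‖} := measurableSet_lt (by fun_prop) (by fun_prop)
  have hbracket : ∫⁻ z : E N, ENNReal.ofReal ((1 + ‖z‖) ^ (-r)) < ⊤ :=
    finite_integral_one_add_norm (by simp [hr, hs])
  have : 0 ≤ r := by positivity
  have hle : ∀ z : E N, 1 < ‖z‖ → ENNReal.ofReal (fracConst N s / ‖z‖ ^ r) ≤
      ENNReal.ofReal (fracConst N s) * ENNReal.ofReal (2 ^ r) *
        ENNReal.ofReal ((1 + ‖z‖) ^ (-r)) := by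
    intro z hz
    have hz0 : 0 < ‖z‖ := by linarith
    have hpow : (‖z‖ ^ r)⁻¹ ≤ 2 ^ r * (1 + ‖z‖) ^ (-r) :=
      calc (‖z‖ ^ r)⁻¹ = 2 ^ r / (2 * ‖z‖) ^ r := by
            rw [Real.mul_rpow two_pos.le hz0.le]
            field_simp
        _ ≤ 2 ^ r / (1 + ‖z‖) ^ r := by
            gcongr
            linarith
        _ = 2 ^ r * (1 + ‖z‖) ^ (-r) := by rw [Real.rpow_neg (by positivity), div_eq_mul_inv]
    rw [div_eq_mul_inv, ENNReal.ofReal_mul' (by positivity), mul_assoc,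
      ← ENNReal.ofReal_mul (p := 2 ^ r) (by positivity)]
    gcongr
  rw [fracMeasure, withDensity_apply _ hmeas]
  refine ne_top_of_le_ne_top ?_
    ((setLIntegral_mono' hmeas hle).trans (setLIntegral_le_lintegral _ _))
  rw [lintegral_const_mul _ (by fun_prop)]
  exact ENNReal.mul_ne_top (ENNReal.mul_ne_top ENNReal.ofReal_ne_top ENNReal.ofReal_ne_top)
    hbracket.ne

theorem fracMeasure_smul (N : ℕ) (s : ℝ) {t : ℝ} (ht : 0 < t) {A : Set (E N)}
    (hA : MeasurableSet A) :
    fracMeasure N s (t • A) = ENNReal.ofReal (t ^ (-(2 * s))) * fracMeasure N s A := by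
  set r : ℝ := N + 2 * s with hr
  set φ : E N → ENNReal := fun z => ENNReal.ofReal (fracConst N s / ‖z‖ ^ r) with hφ
  have hφm : Measurable φ := by fun_prop
  have hscale : Measurable fun z : E N => t⁻¹ • z := measurable_const_smul _
  have hφ_smul : ∀ z, φ z = ENNReal.ofReal (t ^ (-r)) * φ (t⁻¹ • z) := fun z => by
    simp only [hφ]
    rw [← ENNReal.ofReal_mul (by positivity), norm_smul_of_nonneg (by positivity),
      Real.mul_rpow (by positivity) (norm_nonneg z), Real.inv_rpow ht.le, Real.rpow_neg ht.le]
    congr 1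
    field_simp
  rw [fracMeasure, withDensity_apply _ (hA.const_smul₀ t), withDensity_apply _ hA]
  calc ∫⁻ z in t • A, φ z
      = ENNReal.ofReal (t ^ (-r)) * ∫⁻ z in (fun z => t⁻¹ • z) ⁻¹' A, φ (t⁻¹ • z) := by
        rw [Set.preimage_smul_inv₀ ht.ne', ← lintegral_const_mul _ (by fun_prop)]
        exact lintegral_congr hφ_smul
    _ = ENNReal.ofReal (t ^ (-r)) * (ENNReal.ofReal (t ^ (N : ℝ)) * ∫⁻ z in A, φ z) := by
        rw [← setLIntegral_map hA hφm hscale, Measure.map_addHaar_smul _ (inv_ne_zero ht.ne'),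
          Measure.restrict_smul, lintegral_smul_measure, finrank_euclideanSpace_fin, inv_pow,
          inv_inv, abs_of_pos (by positivity), Real.rpow_natCast, smul_eq_mul]
    _ = ENNReal.ofReal (t ^ (-(2 * s))) * ∫⁻ z in A, φ z := by
        rw [← mul_assoc, ← ENNReal.ofReal_mul (by positivity), ← Real.rpow_add ht, hr]
        ring_nf

theorem apertureAngle_le (N : ℕ) (p : ℝ) : apertureAngle N p ≤ Real.pi / 2 := by
  unfold apertureAngle
  split_ifs with h
  exacts [h.choose_spec.1.2, le_rfl]

theorem coordVec_zero_ne_zero {N : ℕ} (hN : 2 ≤ N) : coordVec N 0 ≠ 0 :=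
  norm_ne_zero_iff.1 ((norm_coordVec (by omega)).trans_ne one_ne_zero)

theorem inner_pos_of_mem_truncCone {N : ℕ} (hN : 2 ≤ N) {p : ℝ} {z : E N}
    (hz : z ∈ truncCone N p) : 0 < inner ℝ (coordVec N 0) z := by
  have hz0 : 0 < ‖z‖ := zero_lt_one.trans hz.2
  have hcos : 0 < Real.cos (InnerProductGeometry.angle (coordVec N 0) z) := by
    refine Real.cos_pos_of_mem_Ioo ⟨?_, hz.1.trans_le (apertureAngle_le N p)⟩
    linarith [InnerProductGeometry.angle_nonneg (coordVec N 0) z, Real.pi_pos]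
  rw [← InnerProductGeometry.cos_angle_mul_norm_mul_norm, norm_coordVec (by omega)]
  positivity

theorem smul_truncCone (N : ℕ) (p : ℝ) {t : ℝ} (ht : 1 ≤ t) :
    t • truncCone N p = truncCone N p ∩ {z | t < ‖z‖} := by
  have ht0 : 0 < t := by linarith
  ext z
  rw [Set.mem_smul_set_iff_inv_smul_mem₀ ht0.ne', truncCone, Set.mem_ofPred_eq,
    InnerProductGeometry.angle_smul_right_of_pos _ _ (inv_pos.2 ht0),
    norm_smul_of_nonneg (inv_pos.2 ht0).le, inv_mul_eq_div, one_lt_div ht0]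
  exact ⟨fun h => ⟨⟨h.1, ht.trans_lt h.2⟩, h.2⟩, fun h => ⟨h.1.1, h.2⟩⟩

/-- The law of the vector `z` in one round. -/
noncomputable def jumpLaw (N : ℕ) (p s : ℝ) : Measure (E N) := (fracMeasure N s)[|truncCone N p]

instance (N : ℕ) (p s : ℝ) : IsZeroOrProbabilityMeasure (jumpLaw N p s) := by
  unfold jumpLaw
  infer_instance

section JumpLaw

variable {N : ℕ} (hN : 2 ≤ N) (p : ℝ) {s : ℝ}

include hN

theorem isProbabilityMeasure_jumpLaw (hs : s ∈ Set.Ioo (0 : ℝ) 1) :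
    IsProbabilityMeasure (jumpLaw N p s) := by
  refine cond_isProbabilityMeasure_of_finite ?_ ?_
  · refine fracMeasure_ne_zero_of_isOpen N hs (isOpen_truncCone N p hN)
      (nonempty_truncCone N p hN) fun h0 => ?_
    simpa using (inner_pos_of_mem_truncCone hN h0).ne
  · exact ne_top_of_le_ne_top (fracMeasure_one_lt_norm_ne_top N hs.1)
      (measure_mono fun z hz => hz.2)

theorem jumpLaw_smul (s : ℝ) {t : ℝ} (ht : 1 ≤ t) {A : Set (E N)} (hA : MeasurableSet A)
    (hAT : A ⊆ truncCone N p) :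
    jumpLaw N p s (t • A) = ENNReal.ofReal (t ^ (-(2 * s))) * jumpLaw N p s A := by
  have htAT : t • A ⊆ truncCone N p :=
    (Set.smul_set_mono hAT).trans ((smul_truncCone N p ht).trans_subset Set.inter_subset_left)
  have hT := (isOpen_truncCone N p hN).measurableSet
  rw [jumpLaw, cond_apply hT, cond_apply hT, Set.inter_eq_self_of_subset_right hAT,
    Set.inter_eq_self_of_subset_right htAT, fracMeasure_smul N s (by linarith) hA]
  ring

theorem jumpLaw_lt_norm_le (hs : 0 ≤ s) {t : ℝ} (ht : 0 < t) :
    jumpLaw N p s {z | t < ‖z‖} ≤ ENNReal.ofReal (t ^ (-(2 * s))) := by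
  have hT := (isOpen_truncCone N p hN).measurableSet
  rcases le_total 1 t with h1 | h1
  · rw [jumpLaw, ← cond_inter_self hT, ← smul_truncCone N p h1, ← jumpLaw,
      jumpLaw_smul hN p s h1 hT subset_rfl]
    exact mul_le_of_le_one_right zero_le prob_le_one
  · refine prob_le_one.trans (ENNReal.one_le_ofReal.2 ?_)
    exact Real.one_le_rpow_of_pos_of_le_one_of_nonpos ht h1 (by linarith)

theorem setIntegral_norm_sq_jumpLaw_le (hs : s ∈ Set.Ico (0 : ℝ) 1) {M : ℝ} (hM : 0 ≤ M) :
    ∫ z in {z | ‖z‖ ≤ M}, ‖z‖ ^ 2 ∂(jumpLaw N p s) ≤ M ^ (2 - 2 * s) / (1 - s) := by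
  have hs1 : 0 < 1 - s := sub_pos.2 hs.2
  have h := setIntegral_rpow_le_of_tail (jumpLaw N p s) measurable_norm (fun z => norm_nonneg z)
    two_pos (by linarith) (fun t ht => jumpLaw_lt_norm_le hN p hs.1 ht) hM
  simp only [Real.rpow_two] at h
  refine h.trans_eq ?_
  field_simp

theorem measurePreserving_jumpLaw (s : ℝ) {ρ : E N ≃ₗᵢ[ℝ] E N}
    (hρ : ρ (coordVec N 0) = coordVec N 0) :
    MeasurePreserving ρ (jumpLaw N p s) (jumpLaw N p s) := by
  have hT := (isOpen_truncCone N p hN).measurableSet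
  have hm : Measurable ρ := ρ.continuous.measurable
  have hpre : ρ ⁻¹' truncCone N p = truncCone N p := by
    ext z
    have hangle : InnerProductGeometry.angle (coordVec N 0) (ρ z) =
        InnerProductGeometry.angle (coordVec N 0) z := by
      conv_lhs => rw [← hρ]
      exact ρ.toLinearIsometry.angle_map _ _
    simp [truncCone, hangle]
  have hfrac : ∀ A, MeasurableSet A → fracMeasure N s (ρ ⁻¹' A) = fracMeasure N s A := by
    intro A hA
    rw [fracMeasure, withDensity_apply _ (hm hA), withDensity_apply _ hA,
      ← ρ.measurePreserving.setLIntegral_comp_preimage hA (by fun_prop)]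
    simp only [LinearIsometryEquiv.norm_map]
  refine ⟨hm, Measure.ext fun A hA => ?_⟩
  rw [Measure.map_apply hm hA, jumpLaw, cond_apply hT, cond_apply hT,
    ← hfrac _ (hT.inter hA), Set.preimage_inter, hpre]

/-- The mean is fixed by the reflection in the line `ℝ e₁`, which preserves the law. -/
theorem exists_setIntegral_jumpLaw_eq_smul (s M : ℝ) :
    ∃ m : ℝ, 0 ≤ m ∧ ∫ z in {z | ‖z‖ ≤ M}, z ∂(jumpLaw N p s) = m • coordVec N 0 := by
  have hB : MeasurableSet {z : E N | ‖z‖ ≤ M} := measurableSet_le (by fun_prop) (by fun_prop)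
  have hint : IntegrableOn (fun z : E N => z) {z | ‖z‖ ≤ M} (jumpLaw N p s) :=
    .of_bound (measure_lt_top _ _) measurable_id.aestronglyMeasurable M (ae_restrict_mem hB)
  set I := ∫ z in {z | ‖z‖ ≤ M}, z ∂(jumpLaw N p s) with hI
  let ρ : E N ≃ₗᵢ[ℝ] E N := (Submodule.span ℝ {coordVec N 0}).reflection
  have hρ : ρ (coordVec N 0) = coordVec N 0 :=
    (Submodule.reflection_eq_self_iff _).2 (Submodule.mem_span_singleton_self _)
  have hfix : ρ I = I := by
    have hpre : ρ ⁻¹' {z : E N | ‖z‖ ≤ M} = {z | ‖z‖ ≤ M} := by ext z; simp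
    have hcomp := (measurePreserving_jumpLaw hN p s hρ).setIntegral_preimage_emb
      ρ.toHomeomorph.measurableEmbedding (fun z => z) {z | ‖z‖ ≤ M}
    rw [hpre] at hcomp
    exact (ρ.toContinuousLinearEquiv.toContinuousLinearMap.integral_comp_comm hint).symm.trans hcomp
  obtain ⟨m, hm⟩ := Submodule.mem_span_singleton.1 ((Submodule.reflection_eq_self_iff _).1 hfix)
  refine ⟨m, ?_, hm.symm⟩
  have hinner : inner ℝ (coordVec N 0) I = m := by
    rw [← hm, inner_smul_right, real_inner_self_eq_norm_sq, norm_coordVec (by omega), one_pow,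
      mul_one]
  rw [← hinner, hI, ← integral_inner hint]
  refine integral_nonneg_of_ae (ae_restrict_of_ae ?_)
  filter_upwards [ae_cond_mem (isOpen_truncCone N p hN).measurableSet] with z hz
  exact (inner_pos_of_mem_truncCone hN hz).le

end JumpLaw

/-- A set of jumps, of positive probability, whose direction is close to that of `e₁`; jumps in its
dilates are those by which a player aiming at a point makes the barrier grow. -/
def nearAxis (N : ℕ) (p : ℝ) : Set (E N) :=
  {z | z ∈ truncCone N p ∧ ‖z‖ < 2 ∧ 3 / 4 * ‖z‖ < inner ℝ (coordVec N 0) z}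

theorem nearAxis_subset_truncCone (N : ℕ) (p : ℝ) : nearAxis N p ⊆ truncCone N p :=
  fun _ hz => hz.1

theorem isOpen_nearAxis {N : ℕ} (hN : 2 ≤ N) (p : ℝ) : IsOpen (nearAxis N p) := by
  have hnorm : IsOpen {z : E N | ‖z‖ < 2} := isOpen_lt (by fun_prop) (by fun_prop)
  have hinner : IsOpen {z : E N | 3 / 4 * ‖z‖ < inner ℝ (coordVec N 0) z} :=
    isOpen_lt (by fun_prop) (by fun_prop)
  exact (isOpen_truncCone N p hN).inter (hnorm.inter hinner)

theorem jumpLaw_nearAxis_pos {N : ℕ} (hN : 2 ≤ N) (p : ℝ) {s : ℝ} (hs : s ∈ Set.Ioo (0 : ℝ) 1) :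
    0 < (jumpLaw N p s).real (nearAxis N p) := by
  have he := coordVec_zero_ne_zero hN
  have h1 : ‖coordVec N 0‖ = 1 := norm_coordVec (by omega)
  have hmem : (3 / 2 : ℝ) • coordVec N 0 ∈ nearAxis N p := by
    simp only [nearAxis, truncCone, Set.mem_ofPred_eq, norm_smul, h1, inner_smul_right,
      real_inner_self_eq_norm_sq, InnerProductGeometry.angle_self he,
      InnerProductGeometry.angle_smul_right_of_pos _ _ (show (0 : ℝ) < 3 / 2 by norm_num)]
    exact ⟨⟨apertureAngle_pos N p, by norm_num⟩, by norm_num, by norm_num⟩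
  have hfrac : fracMeasure N s (nearAxis N p) ≠ 0 := by
    refine fracMeasure_ne_zero_of_isOpen N hs (isOpen_nearAxis hN p) ⟨_, hmem⟩ fun h0 => ?_
    simpa using h0.2.2
  refine ENNReal.toReal_pos ?_ (measure_ne_top _ _)
  rw [jumpLaw, cond_apply (isOpen_truncCone N p hN).measurableSet,
    Set.inter_eq_self_of_subset_right (nearAxis_subset_truncCone N p)]
  exact mul_ne_zero (ENNReal.inv_ne_zero.2 (ne_top_of_le_ne_top
    (fracMeasure_one_lt_norm_ne_top N hs.1) (measure_mono fun z hz => hz.2))) hfrac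

section Rotation

theorem reflection_orthogonal_span_singleton_apply {V : Type*} [NormedAddCommGroup V]
    [InnerProductSpace ℝ V] (u x : V) :
    (Submodule.span ℝ {u})ᗮ.reflection x = x - (2 * (inner ℝ u x / ‖u‖ ^ 2)) • u := by
  rw [Submodule.reflection_orthogonal_apply, Submodule.reflection_singleton_apply]
  simp only [RCLike.ofReal_real_eq_id, id_eq, neg_sub, mul_smul, two_smul]

theorem measurable_reflection_orthogonal_span_singleton {V α : Type*} [NormedAddCommGroup V]
    [InnerProductSpace ℝ V] [MeasurableSpace V] [BorelSpace V] [SecondCountableTopology V]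
    [MeasurableSpace α] {f g : α → V} (hf : Measurable f) (hg : Measurable g) :
    Measurable fun q => (Submodule.span ℝ {f q})ᗮ.reflection (g q) := by
  simp only [reflection_orthogonal_span_singleton_apply]
  fun_prop

open Classical in
theorem measurable_rot {N : ℕ} {α : Type*} [MeasurableSpace α] {f g : α → E N}
    (hf : Measurable f) (hg : Measurable g) : Measurable fun q => rot (f q) (g q) := by
  have haxis : Measurable fun q =>
      if f q = -coordVec N 0 then coordVec N 1 else coordVec N 0 + f q :=
    Measurable.ite (hf (measurableSet_singleton _)) measurable_const (by fun_prop)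
  simp only [rot, LinearIsometryEquiv.trans_apply]
  exact measurable_reflection_orthogonal_span_singleton haxis
    (measurable_reflection_orthogonal_span_singleton measurable_const hg)

theorem inner_coordVec_of_ne {N j k : ℕ} (hjk : j ≠ k) :
    inner ℝ (coordVec N j) (coordVec N k) = 0 := by
  simp only [coordVec, PiLp.inner_apply]
  refine Finset.sum_eq_zero fun i _ => ?_
  by_cases hi : i.val = j <;> simp [hi, hjk]

theorem rot_coordVec_zero {N : ℕ} (hN : 2 ≤ N) {y : E N} (hy : ‖y‖ = 1) :
    rot y (coordVec N 0) = y := by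
  have he : ‖coordVec N 0‖ = 1 := norm_coordVec (by omega)
  rw [rot, LinearIsometryEquiv.trans_apply,
    Submodule.reflection_orthogonalComplement_singleton_eq_neg, map_neg]
  split_ifs with h
  · rw [reflection_orthogonal_span_singleton_apply, inner_coordVec_of_ne one_ne_zero, h]
    simp
  · have hsub := Submodule.reflection_sub (v := coordVec N 0) (w := -y) (by rw [norm_neg, he, hy])
    rw [sub_neg_eq_add] at hsub
    rw [hsub, neg_neg]

theorem norm_neg_inv_norm_smul {V : Type*} [NormedAddCommGroup V] [NormedSpace ℝ V] {a : V}
    (ha : a ≠ 0) : ‖-(‖a‖⁻¹ • a)‖ = 1 := by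
  rw [norm_neg, norm_smul, norm_inv, norm_norm, inv_mul_cancel₀ (norm_ne_zero_iff.2 ha)]

theorem norm_smul_rot {N : ℕ} {ε : ℝ} (hε : 0 ≤ ε) (y z : E N) : ‖ε • rot y z‖ = ε * ‖z‖ := by
  rw [norm_smul_of_nonneg hε, LinearIsometryEquiv.norm_map]

end Rotation

section OneRound

/-- The exponents `k` for which the long jumps of a player aiming at the centre of the barrier,
whose gain is exponential in `k`, outweigh all the losses of both players, linear in `k`. -/
def IsAdmissibleExponent (N : ℕ) (p s : ℝ) (k : ℕ) : Prop :=
  2 + k / (2 * (1 - s)) ≤ ((16 / 11) ^ k - 1 - k) * (jumpLaw N p s).real (nearAxis N p)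

theorem exists_isAdmissibleExponent {N : ℕ} (hN : 2 ≤ N) (p : ℝ) {s : ℝ}
    (hs : s ∈ Set.Ioo (0 : ℝ) 1) : ∃ k : ℕ, 1 ≤ k ∧ IsAdmissibleExponent N p s k := by
  have hq := jumpLaw_nearAxis_pos hN p hs
  set q := (jumpLaw N p s).real (nearAxis N p) with hq_def
  set b := 1 / (2 * (1 - s))
  have hpow : Filter.Tendsto (fun k : ℕ => (k : ℝ) / (16 / 11) ^ k) Filter.atTop (nhds 0) := by
    simpa using tendsto_pow_const_div_const_pow_of_one_lt 1 (show (1 : ℝ) < 16 / 11 by norm_num)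
  have hconst : Filter.Tendsto (fun k : ℕ => 1 / (16 / 11 : ℝ) ^ k) Filter.atTop (nhds 0) := by
    simpa using tendsto_pow_const_div_const_pow_of_one_lt 0 (show (1 : ℝ) < 16 / 11 by norm_num)
  have hlim : Filter.Tendsto (fun k : ℕ =>
      (2 + q) * (1 / (16 / 11 : ℝ) ^ k) + (b + q) * (k / (16 / 11) ^ k)) Filter.atTop (nhds 0) := by
    simpa using (hconst.const_mul (2 + q)).add (hpow.const_mul (b + q))
  obtain ⟨k, hlt, hk⟩ := ((hlim.eventually (gt_mem_nhds hq)).and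
    (Filter.eventually_ge_atTop 1)).exists
  refine ⟨k, hk, ?_⟩
  have hmul : (2 + q) + (b + q) * k < q * (16 / 11) ^ k := by
    rw [← div_lt_iff₀ (by positivity)]
    refine lt_of_eq_of_lt ?_ hlt
    ring
  rw [IsAdmissibleExponent, ← hq_def, div_eq_mul_one_div]
  linarith

theorem one_sub_rpow_le_jumpLaw_norm_le {N : ℕ} (hN : 2 ≤ N) (p : ℝ) {s : ℝ}
    (hs : s ∈ Set.Ioo (0 : ℝ) 1) {M : ℝ} (hM : 0 < M) :
    1 - M ^ (-(2 * s)) ≤ (jumpLaw N p s).real {z | ‖z‖ ≤ M} := by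
  have := isProbabilityMeasure_jumpLaw hN p hs
  have htail := ENNReal.toReal_le_of_le_ofReal (by positivity) (jumpLaw_lt_norm_le hN p hs.1.le hM)
  have hcompl : {z : E N | ‖z‖ ≤ M} = {z | M < ‖z‖}ᶜ := by ext z; simp
  rw [hcompl, probReal_compl_eq_one_sub (measurableSet_lt (by fun_prop) (by fun_prop))]
  exact sub_le_sub_left htail 1

theorem integral_rot_eq_smul {N : ℕ} (hN : 2 ≤ N) {y : E N} (hy : ‖y‖ = 1) {P : Measure (E N)}
    {m : ℝ} (hm : ∫ z, z ∂P = m • coordVec N 0) : ∫ z, rot y z ∂P = m • y := by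
  refine ((rot y).toContinuousLinearEquiv.integral_comp_comm (μ := P) (fun z => z)).trans ?_
  rw [hm]
  exact (map_smul (rot y) m _).trans (by rw [rot_coordVec_zero hN hy])

theorem smul_nearAxis_subset_norm_le (N : ℕ) (p : ℝ) {M : ℝ} (hM : 0 ≤ M) :
    (M / 2) • nearAxis N p ⊆ {z | ‖z‖ ≤ M} := by
  rintro _ ⟨w, hw, rfl⟩
  rw [Set.mem_ofPred_eq, norm_smul_of_nonneg (by positivity)]
  nlinarith [hw.2.1]

variable {N : ℕ} (hN : 2 ≤ N) (p : ℝ) {s : ℝ} (hs : s ∈ Set.Ioo (0 : ℝ) 1) (k : ℕ) {c : ℝ}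
  (hc : 0 < c) {ε : ℝ} (hε : 0 < ε) {a : E N} (hca : 2 * c ≤ ‖a‖)

include hN hc hε hca

theorem barrier_mul_le_of_mem_smul_nearAxis {M : ℝ} (hM : 2 * ε * M = ‖a‖) {z : E N}
    (hz : z ∈ (M / 2) • nearAxis N p) :
    barrier k c a * (1 - k * ((2 * inner ℝ a (ε • rot (-(‖a‖⁻¹ • a)) z) +
        ‖ε • rot (-(‖a‖⁻¹ • a)) z‖ ^ 2) / ‖a‖ ^ 2) + ((16 / 11) ^ k - 1 - k)) ≤
      barrier k c (a + ε • rot (-(‖a‖⁻¹ • a)) z) := by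
  have ha : 0 < ‖a‖ := by linarith
  have hM0 : 0 < M := pos_of_mul_pos_right (hM ▸ ha) (by positivity)
  obtain ⟨w, ⟨⟨-, hw1⟩, hw2, hw3⟩, rfl⟩ := hz
  set y := -(‖a‖⁻¹ • a) with hy
  have hy1 : ‖y‖ = 1 := norm_neg_inv_norm_smul (norm_pos_iff.1 ha)
  have hay : a = (-‖a‖) • rot y (coordVec N 0) := by
    rw [rot_coordVec_zero hN hy1, hy, smul_neg, neg_smul, neg_neg, smul_inv_smul₀ ha.ne']
  have hu : ‖ε • rot y ((M / 2) • w)‖ = ‖a‖ / 4 * ‖w‖ := by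
    rw [norm_smul_rot hε.le, norm_smul_of_nonneg (by positivity), ← hM]
    ring
  have hinner : inner ℝ a (ε • rot y ((M / 2) • w)) =
      -(‖a‖ * (‖a‖ / 4) * inner ℝ (coordVec N 0) w) := by
    conv_lhs => rw [hay]
    rw [inner_smul_left, inner_smul_right, LinearIsometryEquiv.inner_map_map, inner_smul_right,
      conj_trivial, ← hM]
    ring
  refine barrier_mul_one_sub_add_le k hc hca ?_ ?_ ?_
  · rw [hu]; nlinarith
  · rw [hu]; nlinarith
  · rw [hu, hinner]
    nlinarith [mul_pos ha ha]

include hs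

/-- With `M = ‖a‖ / (2 ε)`, jumps longer than `M` are discarded; the first-order term of the others
is governed by the mean `m e₁` of the jumps. -/
theorem barrier_mul_le_integral_rot {y : E N} (hy : ‖y‖ = 1) {M m : ℝ} (hM : 2 * ε * M = ‖a‖)
    (hm : ∫ z in {z | ‖z‖ ≤ M}, z ∂(jumpLaw N p s) = m • coordVec N 0) {g : E N → ℝ}
    (hg : IntegrableOn g {z | ‖z‖ ≤ M} (jumpLaw N p s))
    (hstep : ∀ z, ‖z‖ ≤ M →
      barrier k c a * (1 - k * ((2 * inner ℝ a (ε • rot y z) + ‖ε • rot y z‖ ^ 2) / ‖a‖ ^ 2) +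
        g z) ≤ barrier k c (a + ε • rot y z)) :
    barrier k c a * (1 - M ^ (-(2 * s)) -
        k * (2 * (ε * m * inner ℝ a y) / ‖a‖ ^ 2 + M ^ (-(2 * s)) / (4 * (1 - s))) +
        ∫ z in {z | ‖z‖ ≤ M}, g z ∂(jumpLaw N p s)) ≤
      ∫ z, barrier k c (a + ε • rot y z) ∂(jumpLaw N p s) := by
  have := isProbabilityMeasure_jumpLaw hN p hs
  have hs1 : 0 < 1 - s := sub_pos.2 hs.2
  have ha : 0 < ‖a‖ := by linarith
  have hM0 : 0 < M := pos_of_mul_pos_right (hM ▸ ha) (by positivity)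
  have hB : {z | ‖ε • rot y z‖ ≤ ‖a‖ / 2} = {z | ‖z‖ ≤ M} := by
    ext z
    rw [Set.mem_ofPred_eq, Set.mem_ofPred_eq, norm_smul_rot hε.le, ← hM,
      show 2 * ε * M / 2 = ε * M by ring, mul_le_mul_iff_right₀ hε]
  have hmean : inner ℝ a (∫ z in {z | ‖z‖ ≤ M}, ε • rot y z ∂(jumpLaw N p s)) =
      ε * m * inner ℝ a y := by
    rw [integral_smul, integral_rot_eq_smul hN hy hm, inner_smul_right, inner_smul_right, mul_assoc]
  have hsq : (∫ z in {z | ‖z‖ ≤ M}, ‖ε • rot y z‖ ^ 2 ∂(jumpLaw N p s)) / ‖a‖ ^ 2 ≤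
      M ^ (-(2 * s)) / (4 * (1 - s)) := by
    simp only [norm_smul_rot hε.le, mul_pow]
    rw [integral_const_mul, ← hM, div_le_iff₀ (by positivity)]
    calc _ ≤ ε ^ 2 * (M ^ (2 - 2 * s) / (1 - s)) := by
          gcongr
          exact setIntegral_norm_sq_jumpLaw_le hN p ⟨hs.1.le, hs.2⟩ hM0.le
      _ = _ := by
          rw [sub_eq_add_neg, Real.rpow_add hM0, Real.rpow_two]
          field_simp
          norm_num
  have hmain := barrier_mul_le_integral (jumpLaw N p s) k hc.le a
    (U := fun z => ε • rot y z) ((rot y).continuous.measurable.const_smul ε) (g := g)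
    (by rwa [hB]) (fun z hz => hstep z (hB.subset hz))
  rw [hB, hmean, add_div] at hmain
  refine le_trans (mul_le_mul_of_nonneg_left ?_ (barrier_nonneg k c a)) hmain
  gcongr
  exact one_sub_rpow_le_jumpLaw_norm_le hN p hs hM0

variable (hεa : 4 * ε ≤ ‖a‖)

include hεa

theorem barrier_mul_le_integral_rot_neg {M m : ℝ} (hM : 2 * ε * M = ‖a‖)
    (hm : ∫ z in {z | ‖z‖ ≤ M}, z ∂(jumpLaw N p s) = m • coordVec N 0) :
    barrier k c a * (1 - M ^ (-(2 * s)) -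
        k * (-(2 * (ε * m / ‖a‖)) + M ^ (-(2 * s)) / (4 * (1 - s))) +
        (M / 2) ^ (-(2 * s)) * (((16 / 11) ^ k - 1 - k) * (jumpLaw N p s).real (nearAxis N p))) ≤
      ∫ z, barrier k c (a + ε • rot (-(‖a‖⁻¹ • a)) z) ∂(jumpLaw N p s) := by
  have ha : 0 < ‖a‖ := by linarith
  have hM2 : 1 ≤ M / 2 := by
    by_contra! h
    nlinarith
  set G := (M / 2) • nearAxis N p
  set K : ℝ := (16 / 11) ^ k - 1 - k
  have hGm : MeasurableSet G :=
    (isOpen_nearAxis hN p).measurableSet.const_smul₀ _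
  have hG : (jumpLaw N p s).real G =
      (M / 2) ^ (-(2 * s)) * (jumpLaw N p s).real (nearAxis N p) := by
    rw [measureReal_def, jumpLaw_smul hN p s hM2 (isOpen_nearAxis hN p).measurableSet
      (nearAxis_subset_truncCone N p), ENNReal.toReal_mul, ENNReal.toReal_ofReal (by positivity),
      measureReal_def]
  have hmain := barrier_mul_le_integral_rot hN p hs k hc hε hca (y := -(‖a‖⁻¹ • a))
    (norm_neg_inv_norm_smul (norm_pos_iff.1 ha)) hM hm
    (g := G.indicator fun _ => K) ((integrable_const K).indicator hGm) fun z hz => by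
      by_cases hzG : z ∈ G
      · rw [Set.indicator_of_mem hzG]
        exact barrier_mul_le_of_mem_smul_nearAxis hN p k hc hε hca hM hzG
      · rw [Set.indicator_of_notMem hzG, add_zero]
        refine barrier_mul_one_sub_le k hc hca ?_
        rw [norm_smul_rot hε.le, ← hM]
        nlinarith
  have hinner : inner ℝ a (-(‖a‖⁻¹ • a)) = -‖a‖ := by
    rw [inner_neg_right, inner_smul_right, real_inner_self_eq_norm_sq]
    field_simp
  rw [setIntegral_indicator hGm, setIntegral_const, smul_eq_mul, hinner,
    Set.inter_eq_self_of_subset_right (smul_nearAxis_subset_norm_le N p (by linarith)), hG] at hmain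
  refine le_of_eq_of_le ?_ hmain
  field_simp

theorem two_mul_barrier_le_integral_add (hk : IsAdmissibleExponent N p s k) {y : E N}
    (hy : ‖y‖ = 1) :
    2 * barrier k c a ≤
      (∫ z, barrier k c (a + ε • rot (-(‖a‖⁻¹ • a)) z) ∂(jumpLaw N p s)) +
        ∫ z, barrier k c (a + ε • rot y z) ∂(jumpLaw N p s) := by
  have ha : 0 < ‖a‖ := by linarith
  set M := ‖a‖ / (2 * ε)
  have hM : 2 * ε * M = ‖a‖ := mul_div_cancel₀ _ (by positivity)
  obtain ⟨m, hm0, hm⟩ := exists_setIntegral_jumpLaw_eq_smul hN p s M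
  have hI := barrier_mul_le_integral_rot_neg hN p hs k hc hε hca hεa hM hm
  have hII := barrier_mul_le_integral_rot hN p hs k hc hε hca hy hM hm (g := 0)
    integrableOn_zero fun z hz => by
      rw [Pi.zero_apply, add_zero]
      refine barrier_mul_one_sub_le k hc hca ?_
      rw [norm_smul_rot hε.le, ← hM]
      nlinarith
  simp only [Pi.zero_apply, integral_zero, add_zero] at hII
  have hy' : 2 * (ε * m * inner ℝ a y) / ‖a‖ ^ 2 ≤ 2 * (ε * m / ‖a‖) := by
    have := real_inner_le_norm a y
    rw [hy, mul_one] at this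
    calc _ ≤ 2 * (ε * m * ‖a‖) / ‖a‖ ^ 2 := by gcongr
      _ = _ := by field_simp
  have hgain : M ^ (-(2 * s)) * (2 + k / (2 * (1 - s))) ≤
      (M / 2) ^ (-(2 * s)) *
        (((16 / 11) ^ k - 1 - k) * (jumpLaw N p s).real (nearAxis N p)) := by
    have hs1 : 0 < 1 - s := sub_pos.2 hs.2
    have hMpos : 0 < M := by positivity
    refine mul_le_mul ?_ hk (by positivity) (by positivity)
    exact Real.rpow_le_rpow_of_nonpos (by positivity) (by linarith) (by linarith [hs.1])
  refine le_trans ?_ (add_le_add hI hII)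
  rw [← mul_add, mul_comm]
  refine mul_le_mul_of_nonneg_left ?_ (barrier_nonneg k c a)
  have hcurv : M ^ (-(2 * s)) * (2 + k / (2 * (1 - s))) =
      2 * M ^ (-(2 * s)) + 2 * (k * (M ^ (-(2 * s)) / (4 * (1 - s)))) := by
    field_simp
    ring
  linarith [mul_le_mul_of_nonneg_left hy' (Nat.cast_nonneg (α := ℝ) k)]

end OneRound

theorem lintegral_stepLaw {N : ℕ} (p s : ℝ) {f : Outcome N → ENNReal} (hf : Measurable f) :
    ∫⁻ o, f o ∂(stepLaw N p s) =
      ((∫⁻ z, f (z, true) ∂(jumpLaw N p s)) + ∫⁻ z, f (z, false) ∂(jumpLaw N p s)) / 2 := by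
  rw [stepLaw, ← jumpLaw, lintegral_prod_symm _ hf.aemeasurable, lintegral_fintype,
    Fintype.sum_bool, uniformOn_univ, uniformOn_univ]
  simp [div_eq_mul_inv, add_mul]

theorem isProbabilityMeasure_stepLaw_of_mem_Ioo {N : ℕ} (hN : 2 ≤ N) (p : ℝ) {s : ℝ}
    (hs : s ∈ Set.Ioo (0 : ℝ) 1) : IsProbabilityMeasure (stepLaw N p s) := by
  have := isProbabilityMeasure_jumpLaw hN p hs
  have := isProbabilityMeasure_uniformOn (s := (Set.univ : Set Bool)) Set.finite_univ
    Set.univ_nonempty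
  rw [stepLaw, ← jumpLaw]
  infer_instance

section Game

variable {N : ℕ} (ε : ℝ) (x : E N) (σI σII : Strategy N)

theorem History.measurable_pos : ∀ n : ℕ, Measurable (History.pos : History N n → E N)
  | 0 => measurable_fst
  | n + 1 => ((measurable_pi_apply (Fin.last n)).comp measurable_snd).fst

/-- The position after the round that follows the history `H`, if its random data are `o`. -/
noncomputable def move {n : ℕ} (H : History N n) (o : Outcome N) : E N :=
  H.pos + ε • rot (if o.2 = true then σI.dir n H else σII.dir n H : Metric.sphere (0 : E N) 1) o.1

theorem measurable_move (n : ℕ) :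
    Measurable fun q : History N n × Outcome N => move ε σI σII q.1 q.2 := by
  have hdir : Measurable fun q : History N n × Outcome N =>
      if q.2.2 = true then σI.dir n q.1 else σII.dir n q.1 :=
    .ite (measurable_snd.snd (measurableSet_singleton true))
      ((σI.measurable_dir n).comp measurable_fst) ((σII.measurable_dir n).comp measurable_fst)
  exact ((History.measurable_pos n).comp measurable_fst).add
    ((measurable_rot (measurable_subtype_coe.comp hdir) measurable_snd.fst).const_smul ε)

theorem history_succ (ω : ℕ → Outcome N) (n : ℕ) :
    history ε x σI σII ω (n + 1) = (x, Fin.snoc (history ε x σI σII ω n).2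
      (move ε σI σII (history ε x σI σII ω n) (ω n), ω n)) := rfl

theorem position_succ (n : ℕ) (ω : ℕ → Outcome N) :
    position ε x σI σII (n + 1) ω = move ε σI σII (history ε x σI σII ω n) (ω n) := by
  simp only [position, history_succ, History.pos, Fin.snoc_last]

theorem measurable_history : ∀ n : ℕ, Measurable fun ω => history ε x σI σII ω n
  | 0 => measurable_const
  | n + 1 => by
    have ih := measurable_history n
    simp only [history_succ]
    refine measurable_const.prodMk (measurable_pi_iff.2 fun i => ?_)
    refine Fin.lastCases ?_ (fun j => ?_) i
    · simp only [Fin.snoc_last]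
      exact ((measurable_move ε σI σII n).comp
        (ih.prodMk (measurable_pi_apply n))).prodMk (measurable_pi_apply n)
    · simp only [Fin.snoc_castSucc]
      exact (measurable_pi_apply j).comp (measurable_snd.comp ih)

theorem measurable_position (n : ℕ) : Measurable (position ε x σI σII n) :=
  (History.measurable_pos n).comp (measurable_history ε x σI σII n)

theorem dependsOn_history :
    ∀ n : ℕ, DependsOn (fun ω => history ε x σI σII ω n) (Set.Iio n)
  | 0 => fun _ _ _ => rfl
  | n + 1 => fun ω ω' h => by
    have ih : history ε x σI σII ω n = history ε x σI σII ω' n :=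
      dependsOn_history n fun i hi => h i (hi.trans n.lt_succ_self)
    simp only [history_succ, ih, h n n.lt_succ_self]

variable {p s : ℝ} {G : Set (E N)} (hG : MeasurableSet G) {v : E N → ENNReal} (hv : Measurable v)
  (hstep : ∀ n (H : History N n), H.pos ∈ G → ∀ y : E N, ‖y‖ = 1 →
    (∫⁻ z, v (H.pos + ε • rot (σI.dir n H : E N) z) ∂(jumpLaw N p s)) +
      ∫⁻ z, v (H.pos + ε • rot y z) ∂(jumpLaw N p s) ≤ 2 * v H.pos)

include hv hstep

theorem lintegral_move_le {n : ℕ} {H : History N n} (hH : H.pos ∈ G) :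
    ∫⁻ o, v (move ε σI σII H o) ∂(stepLaw N p s) ≤ v H.pos := by
  have hm : Measurable fun o => v (move ε σI σII H o) :=
    hv.comp ((measurable_move ε σI σII n).comp measurable_prodMk_left)
  rw [lintegral_stepLaw p s hm]
  refine ENNReal.div_le_of_le_mul' ?_
  simpa only [move, if_true, Bool.false_eq_true, if_false]
    using hstep n H hH (σII.dir n H) (norm_eq_of_mem_sphere _)

include hG

theorem setLIntegral_position_succ_le (hP : IsProbabilityMeasure (stepLaw N p s)) (n : ℕ) :
    ∫⁻ ω in {ω | ∀ k < n + 1, position ε x σI σII k ω ∈ G},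
        v (position ε x σI σII (n + 1) ω) ∂(gameLaw N p s) ≤
      ∫⁻ ω in {ω | ∀ k < n + 1, position ε x σI σII k ω ∈ G},
        v (position ε x σI σII n ω) ∂(gameLaw N p s) := by
  set A := {ω | ∀ k < n + 1, position ε x σI σII k ω ∈ G} with hA_def
  have hA : MeasurableSet A := by
    simp only [hA_def, Set.ofPred_forall]
    exact .iInter fun k => .iInter fun _ => measurable_position ε x σI σII k hG
  let F : (ℕ → Outcome N) → Outcome N → ENNReal := fun ω o =>
    A.indicator (fun ω => v (move ε σI σII (history ε x σI σII ω n) o)) ω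
  have hF : Measurable (Function.uncurry F) :=
    (hv.comp ((measurable_move ε σI σII n).comp (((measurable_history ε x σI σII n).comp
      measurable_fst).prodMk measurable_snd))).indicator (measurable_fst hA)
  have hdep : DependsOn F {n}ᶜ := fun ω ω' h => by
    have hhist : ∀ k < n + 1, history ε x σI σII ω k = history ε x σI σII ω' k := fun k hk =>
      dependsOn_history ε x σI σII k fun i hi => h i (by grind)
    have hmem : ω ∈ A ↔ ω' ∈ A := forall₂_congr fun k hk => by
      rw [position, position, hhist k hk]
    funext o
    by_cases hω : ω ∈ A
    · simp only [F, Set.indicator_of_mem hω, Set.indicator_of_mem (hmem.1 hω),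
        hhist n n.lt_succ_self]
    · simp only [F, Set.indicator_of_notMem hω, Set.indicator_of_notMem (mt hmem.2 hω)]
  calc _ = ∫⁻ ω, F ω (ω n) ∂(gameLaw N p s) := by
        simp only [← lintegral_indicator hA, position_succ, F, Set.indicator]
    _ = ∫⁻ ω, ∫⁻ o, F ω o ∂(stepLaw N p s) ∂(gameLaw N p s) :=
        lintegral_infinitePi_eval _ n hF hdep
    _ ≤ ∫⁻ ω, A.indicator (fun ω => v (position ε x σI σII n ω)) ω ∂(gameLaw N p s) := by
        refine lintegral_mono fun ω => ?_
        by_cases hω : ω ∈ A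
        · simp only [F, Set.indicator_of_mem hω]
          exact lintegral_move_le ε σI σII hv hstep (hω n n.lt_succ_self)
        · simp only [F, Set.indicator_of_notMem hω, lintegral_zero, le_refl]
    _ = _ := lintegral_indicator hA _

theorem gameLaw_exists_enter_le (hP : IsProbabilityMeasure (stepLaw N p s)) {K : Set (E N)}
    (hK : MeasurableSet K) (hGK : Disjoint G K) (hvK : ∀ y ∈ K, 1 ≤ v y) :
    gameLaw N p s {ω | ∃ n, (∀ k < n, position ε x σI σII k ω ∈ G) ∧
      position ε x σI σII n ω ∈ K} ≤ v x := by
  have : IsProbabilityMeasure (gameLaw N p s) := by unfold gameLaw; infer_instance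
  refine (measure_exists_enter_le _ (measurable_position ε x σI σII) hG hK hGK hvK
    (setLIntegral_position_succ_le ε x σI σII hG hv hstep hP)).trans_eq ?_
  simp only [position, history, History.pos, lintegral_const, measure_univ, mul_one]

end Game

section Aiming

variable {N : ℕ} (hN : 2 ≤ N) (z₀ : E N)

open Classical in
/-- The unit vector that points from `x` to `z₀`, with the value `e₁` for `x = z₀`. -/
noncomputable def unitToward (x : E N) : Metric.sphere (0 : E N) 1 :=
  ⟨if x = z₀ then coordVec N 0 else -(‖x - z₀‖⁻¹ • (x - z₀)), by
    rw [mem_sphere_zero_iff_norm]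
    split_ifs with h
    · exact norm_coordVec (by omega)
    · exact norm_neg_inv_norm_smul (sub_ne_zero.2 h)⟩

theorem measurable_unitToward : Measurable (unitToward hN z₀) :=
  .subtype_mk (.ite (measurableSet_singleton z₀) measurable_const (by fun_prop))

/-- The strategy of always aiming at `z₀`. -/
noncomputable def aimStrategy : Strategy N where
  dir _ H := unitToward hN z₀ H.pos
  measurable_dir n := (measurable_unitToward hN z₀).comp (History.measurable_pos n)

end Aiming

section Exit

variable {N : ℕ} {D U : Set (E N)} {ε : ℝ} {x : E N} {σI σII : Strategy N} {ω : ℕ → Outcome N}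
  {n : ℕ}

theorem position_mem_of_lt_exitTime {k : ℕ} (hx : x ∈ D)
    (h : (n : ℕ∞) < exitTime D ε x σI σII ω) (hk : k ≤ n) : position ε x σI σII k ω ∈ D := by
  by_contra hD
  rcases Nat.eq_zero_or_pos k with rfl | hk0
  · exact hD hx
  · have : exitTime D ε x σI σII ω ≤ (k : ℕ∞) := iInf₂_le k ⟨hk0, hD⟩
    exact absurd (h.trans_le this) (not_lt.2 (by exact_mod_cast hk))

theorem exists_first_exit (hx : x ∈ D) (h : (n : ℕ∞) < exitTime D ε x σI σII ω)
    (hn : position ε x σI σII n ω ∉ U) :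
    ∃ m, (∀ k < m, position ε x σI σII k ω ∈ D ∩ U) ∧ position ε x σI σII m ω ∈ D \ U := by
  classical
  have hex : ∃ m, position ε x σI σII m ω ∉ U := ⟨n, hn⟩
  have hle : Nat.find hex ≤ n := Nat.find_min' hex hn
  refine ⟨Nat.find hex, fun k hk => ⟨position_mem_of_lt_exitTime hx h (hk.le.trans hle), ?_⟩,
    position_mem_of_lt_exitTime hx h hle, Nat.find_spec hex⟩
  exact not_not.1 (Nat.find_min hex hk)

end Exit

section Leave

variable {N : ℕ} (k : ℕ) {c : ℝ} (R : ℝ) (z₀ : E N)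

/-- The barrier turned upside down and centred at `z₀`, normalised to be at least `1` at distance
`R` or more from `z₀`. Along the game it bounds the probability of getting that far. -/
noncomputable def escapeBound (c : ℝ) (x : E N) : ℝ :=
  1 + (c / R) ^ (2 * k) - barrier k c (x - z₀)

theorem measurable_escapeBound : Measurable (escapeBound k R z₀ c) :=
  ((measurable_barrier k c).comp (measurable_id.sub_const z₀)).const_sub _

theorem escapeBound_nonneg (hc : 0 ≤ c) (x : E N) : 0 ≤ escapeBound k R z₀ c x := by
  have hpow : 0 ≤ (c / R) ^ (2 * k) := (even_two_mul k).pow_nonneg _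
  have hbar := barrier_le_one k hc (x - z₀)
  unfold escapeBound
  linarith

variable {R} in
theorem one_le_escapeBound (hc : 0 ≤ c) (hR : 0 < R) {x : E N} (hx : R ≤ ‖x - z₀‖) :
    1 ≤ escapeBound k R z₀ c x := by
  have hbar := barrier_le k hc hR hx
  unfold escapeBound
  linarith

variable (hN : 2 ≤ N) (p : ℝ) {s : ℝ} (hs : s ∈ Set.Ioo (0 : ℝ) 1)
  (hk : IsAdmissibleExponent N p s k) (hc : 0 < c) {ε : ℝ} (hε : 0 < ε) (hεc : 2 * ε ≤ c)

include hN hs hk hc hε hεc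

variable {z₀} in
theorem lintegral_escapeBound_add_le {x y : E N} (hx : 2 * c ≤ ‖x - z₀‖) (hy : ‖y‖ = 1) :
    (∫⁻ z, ENNReal.ofReal (escapeBound k R z₀ c (x + ε • rot (unitToward hN z₀ x : E N) z))
        ∂(jumpLaw N p s)) +
      ∫⁻ z, ENNReal.ofReal (escapeBound k R z₀ c (x + ε • rot y z)) ∂(jumpLaw N p s) ≤
      2 * ENNReal.ofReal (escapeBound k R z₀ c x) := by
  have := isProbabilityMeasure_jumpLaw hN p hs
  have hne : x ≠ z₀ := fun h => by
    rw [h, sub_self, norm_zero] at hx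
    linarith
  have hbar : ∀ y : E N,
      Integrable (fun z => barrier k c (x - z₀ + ε • rot y z)) (jumpLaw N p s) := fun y =>
    integrable_barrier_comp _ k hc.le (((rot y).continuous.measurable.const_smul ε).const_add _)
  have hshift : ∀ y z, escapeBound k R z₀ c (x + ε • rot y z) =
      1 + (c / R) ^ (2 * k) - barrier k c (x - z₀ + ε • rot y z) := fun y z => by
    rw [escapeBound, add_sub_right_comm x]
  have hint : ∀ y : E N,
      Integrable (fun z => escapeBound k R z₀ c (x + ε • rot y z)) (jumpLaw N p s) := fun y => by
    simp only [hshift]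
    exact (integrable_const _).sub (hbar y)
  have hnonneg : ∀ y z, 0 ≤ escapeBound k R z₀ c (x + ε • rot y z) := fun y z =>
    escapeBound_nonneg k R z₀ hc.le _
  rw [← ofReal_integral_eq_lintegral_ofReal (hint _) (.of_forall (hnonneg _)),
    ← ofReal_integral_eq_lintegral_ofReal (hint _) (.of_forall (hnonneg _)),
    ← ENNReal.ofReal_add (integral_nonneg (hnonneg _)) (integral_nonneg (hnonneg _)),
    two_mul (ENNReal.ofReal _), ← ENNReal.ofReal_add (escapeBound_nonneg k R z₀ hc.le x)
      (escapeBound_nonneg k R z₀ hc.le x)]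
  refine ENNReal.ofReal_le_ofReal ?_
  have hstep := two_mul_barrier_le_integral_add hN p hs k hc hε hx (by linarith) hk hy
  simp only [hshift]
  rw [integral_sub (integrable_const _) (hbar _), integral_sub (integrable_const _) (hbar _),
    integral_const, probReal_univ, one_smul]
  simp only [unitToward, if_neg hne, escapeBound]
  linarith

variable {R} in
theorem gameLaw_leave_le (hR : 0 < R) {D U : Set (E N)} (hD : MeasurableSet D)
    (hU : MeasurableSet U) (hz₀ : ∀ X ∈ D, 2 * c ≤ ‖X - z₀‖) (hDU : ∀ X ∈ D \ U, R ≤ ‖X - z₀‖)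
    {x : E N} (hx : x ∈ D) (σII : Strategy N) :
    (gameLaw N p s).real {ω | ∃ n : ℕ, (n : ℕ∞) < exitTime D ε x (aimStrategy hN z₀) σII ω ∧
        position ε x (aimStrategy hN z₀) σII n ω ∉ U} ≤ escapeBound k R z₀ c x := by
  have henter := gameLaw_exists_enter_le ε x (aimStrategy hN z₀) σII (hD.inter hU)
    (measurable_escapeBound k R z₀).ennreal_ofReal
    (fun _ _ hH _ hy =>
      lintegral_escapeBound_add_le k R hN p hs hk hc hε hεc (hz₀ _ hH.1) hy)
    (isProbabilityMeasure_stepLaw_of_mem_Ioo hN p hs) (hD.diff hU)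
    (Set.disjoint_sdiff_right.mono_left Set.inter_subset_right) fun X hX =>
      ENNReal.one_le_ofReal.2 (one_le_escapeBound k z₀ hc.le hR (hDU X hX))
  refine ENNReal.toReal_le_of_le_ofReal (escapeBound_nonneg k R z₀ hc.le x)
    ((measure_mono ?_).trans henter)
  rintro ω ⟨n, hn, hnU⟩
  exact exists_first_exit hx hn hnU

end Leave

section Cone

theorem exists_angle_lt_of_norm_sub_lt {V : Type*} [NormedAddCommGroup V] [InnerProductSpace ℝ V]
    {v : V} (hv : v ≠ 0) {β : ℝ} (hβ : 0 < β) : ∃ κ : ℝ, 0 < κ ∧ κ ≤ 1 ∧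
      ∀ w : V, ‖w - v‖ < κ → InnerProductGeometry.angle v w < β := by
  have hcont : ContinuousAt (fun w : V => InnerProductGeometry.angle v w) v :=
    (InnerProductGeometry.continuousAt_angle (x := (v, v)) hv hv).comp
      (f := fun w : V => (v, w)) (by fun_prop)
  have hnear := hcont.eventually (gt_mem_nhds ((InnerProductGeometry.angle_self hv).trans_lt hβ))
  obtain ⟨κ, hκ, hball⟩ := Metric.eventually_nhds_iff.1 hnear
  refine ⟨min κ 1, lt_min hκ one_pos, min_le_right _ _, fun w hw => hball ?_⟩
  rw [dist_eq_norm]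
  exact hw.trans_le (min_le_left _ _)

variable {N : ℕ} {v : E N} (hv : ‖v‖ = 1) {β : ℝ}

include hv

theorem mem_finiteCone_of_norm_sub_lt {h κ r : ℝ} (hκ1 : κ ≤ 1)
    (hκ : ∀ w : E N, ‖w - v‖ < κ → InnerProductGeometry.angle v w < β) (hr : 0 < r)
    (hrh : 2 * r ≤ h) {z : E N} (hz : ‖z - r • v‖ < κ * r) : z ∈ finiteCone v β h := by
  have hrv : ‖r • v‖ = r := by rw [norm_smul_of_nonneg hr.le, hv, mul_one]
  have hκr : κ * r ≤ r := mul_le_of_le_one_left hr.le hκ1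
  refine ⟨?_, ?_, ?_⟩
  · rw [← InnerProductGeometry.angle_smul_right_of_pos v z (inv_pos.2 hr)]
    have hscale : r⁻¹ • z - v = r⁻¹ • (z - r • v) := by rw [smul_sub, inv_smul_smul₀ hr.ne']
    refine hκ _ ?_
    rwa [hscale, norm_smul_of_nonneg (inv_pos.2 hr).le, inv_mul_eq_div, div_lt_iff₀ hr]
  · have := norm_sub_norm_le (r • v) z
    rw [norm_sub_rev, hrv] at this
    linarith
  · have := norm_sub_norm_le z (r • v)
    rw [hrv] at this
    linarith

theorem le_norm_sub_of_cone_subset_compl {h κ r : ℝ} (hκ1 : κ ≤ 1)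
    (hκ : ∀ w : E N, ‖w - v‖ < κ → InnerProductGeometry.angle v w < β) (hr : 0 < r)
    (hrh : 2 * r ≤ h) {D : Set (E N)} {x : E N} {S : E N ≃ₗᵢ[ℝ] E N}
    (hS : ∀ z ∈ finiteCone v β h, x + S z ∉ D) {X : E N} (hX : X ∈ D) :
    κ * r ≤ ‖X - (x + S (r • v))‖ := by
  by_contra! hlt
  refine hS (S.symm (X - x)) (mem_finiteCone_of_norm_sub_lt hv hκ1 hκ hr hrh ?_) (by simpa using hX)
  rwa [← S.norm_map, map_sub, LinearIsometryEquiv.apply_symm_apply, sub_sub]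

/-- Player I aims at the centre `x + S (r • v)` of a ball of radius `κ r` inside the cone. -/
theorem exists_strategy_leave_ball_le (hN : 2 ≤ N) (p : ℝ) {s : ℝ} (hs : s ∈ Set.Ioo (0 : ℝ) 1)
    {k : ℕ} (hk : IsAdmissibleExponent N p s k) {h κ r δ : ℝ} (hκ0 : 0 < κ) (hκ1 : κ ≤ 1)
    (hκ : ∀ w : E N, ‖w - v‖ < κ → InnerProductGeometry.angle v w < β) (hr : 0 < r)
    (hrh : 2 * r ≤ h) (hrδ : 5 * r ≤ δ) {ε : ℝ} (hε : 0 < ε) (hεr : 4 * ε ≤ κ * r)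
    {D : Set (E N)} (hD : MeasurableSet D) {x : E N} {S : E N ≃ₗᵢ[ℝ] E N}
    (hS : ∀ z ∈ finiteCone v β h, x + S z ∉ D) {x₀ : E N} (hx₀ : x₀ ∈ Metric.ball x r ∩ D) :
    ∃ σI : Strategy N, ∀ σII : Strategy N, (gameLaw N p s).real
        {ω | ∃ n : ℕ, (n : ℕ∞) < exitTime D ε x₀ σI σII ω ∧
          position ε x₀ σI σII n ω ∉ Metric.ball x δ} ≤
      1 + (κ / 8) ^ (2 * k) - (κ / 4) ^ (2 * k) := by
  set z₀ := x + S (r • v) with hz₀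
  have hz₀x : ‖z₀ - x‖ = r := by
    rw [hz₀, add_sub_cancel_left, S.norm_map, norm_smul_of_nonneg hr.le, hv, mul_one]
  have havoid : ∀ X ∈ D, 2 * (κ * r / 2) ≤ ‖X - z₀‖ := fun X hX => by
    rw [mul_div_cancel₀ _ two_ne_zero]
    exact le_norm_sub_of_cone_subset_compl hv hκ1 hκ hr hrh hS hX
  have hfar : ∀ X ∈ D \ Metric.ball x δ, 4 * r ≤ ‖X - z₀‖ := fun X hX => by
    have hXx : δ ≤ ‖X - x‖ := by
      simpa only [Metric.mem_ball, not_lt, dist_eq_norm] using hX.2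
    linarith [norm_sub_le_norm_sub_add_norm_sub X z₀ x]
  have hstart : ‖x₀ - z₀‖ ≤ 2 * r := by
    have hx₀x : ‖x₀ - x‖ < r := by
      simpa only [Metric.mem_ball, dist_eq_norm] using hx₀.1
    linarith [norm_sub_le_norm_sub_add_norm_sub x₀ x z₀, norm_sub_rev x z₀]
  refine ⟨aimStrategy hN z₀, fun σII => (gameLaw_leave_le k z₀ hN p hs hk (by positivity) hε
    (by linarith) (by positivity) hD measurableSet_ball havoid hfar hx₀.2 σII).trans ?_⟩
  have hbar := le_barrier k (c := κ * r / 2) (by positivity) (by nlinarith) hstart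
  rw [show κ * r / 2 / (2 * r) = κ / 4 by field_simp; norm_num] at hbar
  rw [escapeBound, show κ * r / 2 / (4 * r) = κ / 8 by field_simp; norm_num]
  linarith

end Cone

end FracTug

theorem theorem7p2_general (N : ℕ) (hN : 2 ≤ N) (p : ℝ) (_hp : 2 ≤ p) (s : ℝ)
    (hs : s ∈ Set.Ioo (0 : ℝ) 1) (v : FracTug.E N) (hv : ‖v‖ = 1) (β : ℝ) (hβ : 0 < β) (h : ℝ)
    (hh : 0 < h) :
    ∃ θ : ℝ, θ < 1 ∧ ∀ δ : ℝ, 0 < δ → ∃ δ' : ℝ, 0 < δ' ∧ δ' < δ ∧ ∃ ε' : ℝ, 0 < ε' ∧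
      ∀ ε : ℝ, 0 < ε → ε < ε' → ∀ D : Set (FracTug.E N), MeasurableSet D → ∀ x : FracTug.E N,
        (∃ S : FracTug.E N ≃ₗᵢ[ℝ] FracTug.E N, ∀ z ∈ FracTug.finiteCone v β h, x + S z ∉ D) →
        ∀ x₀ ∈ Metric.ball x δ' ∩ D,
          ∃ σI : FracTug.Strategy N, ∀ σII : FracTug.Strategy N,
            (FracTug.gameLaw N p s).real
              {ω | ∃ n : ℕ,
                (n : ℕ∞) < FracTug.exitTime D ε x₀ σI σII ω ∧
                  FracTug.position ε x₀ σI σII n ω ∉ Metric.ball x δ} ≤ θ := by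
  obtain ⟨k, hk1, hk⟩ := FracTug.exists_isAdmissibleExponent hN p hs
  obtain ⟨κ, hκ, hκ1, hκβ⟩ := FracTug.exists_angle_lt_of_norm_sub_lt
    (norm_ne_zero_iff.1 (hv.trans_ne one_ne_zero)) hβ
  have hgap : (κ / 8) ^ (2 * k) < (κ / 4) ^ (2 * k) :=
    pow_lt_pow_left₀ (by linarith) (by positivity) (by omega)
  refine ⟨1 + (κ / 8) ^ (2 * k) - (κ / 4) ^ (2 * k), by linarith, fun δ hδ => ?_⟩
  obtain ⟨r, hr, hrmin⟩ : ∃ r, 0 < r ∧ 5 * r = min δ h :=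
    ⟨min δ h / 5, by positivity, by ring⟩
  obtain ⟨hrδ, hrh⟩ := le_min_iff.1 hrmin.le
  refine ⟨r, hr, by linarith, κ * r / 4, by positivity, ?_⟩
  rintro ε hε hεr D hD x ⟨S, hS⟩ x₀ hx₀
  exact FracTug.exists_strategy_leave_ball_le hv hN p hs hk hκ hκ1 hκβ hr (by linarith) hrδ hε
    (by linarith) hD hS hx₀

theorem theorem7p2 (N : ℕ) (hN : 2 ≤ N) (p : ℝ) (hp : 2 ≤ p) (s : ℝ)
    (hs : s ∈ Set.Ioo (1 / 2 : ℝ) 1) (v : FracTug.E N) (hv : ‖v‖ = 1) (β : ℝ)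
    (hβ : β ∈ Set.Ioo 0 Real.pi) (h : ℝ) (hh : 0 < h) :
    ∃ θ : ℝ, θ < 1 ∧
      ∀ D : Set (FracTug.E N), IsOpen D → Bornology.IsBounded D →
        FracTug.ExternalCone D (FracTug.finiteCone v β h) →
        ∀ δ : ℝ, 0 < δ →
          ∃ δ' : ℝ, 0 < δ' ∧ δ' < δ ∧ ∃ ε' : ℝ, 0 < ε' ∧
            ∀ ε : ℝ, 0 < ε → ε < ε' →
              ∀ x ∈ frontier D, ∀ x₀ ∈ Metric.ball x δ' ∩ D,
                ∃ σI : FracTug.Strategy N, ∀ σII : FracTug.Strategy N,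
                  (FracTug.gameLaw N p s).real
                    {ω | ∃ n : ℕ,
                      (n : ℕ∞) < FracTug.exitTime D ε x₀ σI σII ω ∧
                        FracTug.position ε x₀ σI σII n ω ∉ Metric.ball x δ} ≤ θ := by
  obtain ⟨θ, hθ, H⟩ := theorem7p2_general N hN p hp s ⟨by linarith [hs.1], hs.2⟩ v hv β hβ.1 h hh
  refine ⟨θ, hθ, fun D hD _ hcone δ hδ => ?_⟩
  obtain ⟨δ', hδ', hδ'δ, ε', hε', hθε⟩ := H δ hδ
  exact ⟨δ', hδ', hδ'δ, ε', hε', fun ε hε hεε' x hx =>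
    hθε ε hε hεε' D hD.measurableSet x ((hcone x hx).imp fun _ hS => hS.2)⟩
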